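/- **Theorem (Preservation of $\mathsf F_{<:M}$).** The calculus $\mathsf F_{<:M}$ (System $\mathsf F_{<:}$ with type qualifiers, qualifier polymorphism and mutable references) is defined as follows; terms and types are taken up to renaming of bound variables, and every type, bound and qualifier that occurs is well scoped. *Syntax.* Qualifiers $P,Q,R ::= \top \mid \bot \mid Y \mid Q\wedge R \mid Q\vee R$, where $\top$ is `readonly`, $\bot$ is `mutable`, and $Y$ is a qualifier variable. Qualified types $T,U ::= \{Q\}\,S$; simple types $S,B ::= \top \mid X \mid T\to U \mid \forall(X<:B).T \mid \forall(Y<:Q).T \mid \mathrm{box}\,T$. Terms $s,t ::= x \mid \lambda_P(x).t \mid \Lambda_P(X<:B).t \mid \Lambda_P(Y<:Q).t \mid s\,t \mid s[S] \mid s\{\!\{Q\}\!\} \mid \mathrm{upqual}\,P\,s \mid \mathrm{assert}\,P\,s \mid \mathrm{box}_P\,s \mid l_P \mid \mathrm{unbox}\,s \mid \mathrm{setbox}\,s\,t$, with $l$ a store location. The values $v,w$ are the three abstractions and $l_P$; each is tagged with its $P$. Contexts $\Gamma$ are finite lists of bindings $x:T$, $X<:B$, $Y<:Q$, each in the scope of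 the earlier ones. A store $\sigma$ is a finite partial map from locations to values. A store environment $\Sigma$ is a partial map from locations to qualified types in the scope of $\Gamma$. *Reduction.* $\mathrm{eval}(Q)\in\{\bot\sqsubseteq\top\}$ is the value of a variable-free qualifier in the two-point lattice, and is undefined if $Q$ contains a variable. Reduction is call-by-value, left to right, in all argument positions of $s\,t$, $s[S]$, $s\{\!\{Q\}\!\}$, $\mathrm{upqual}$, $\mathrm{assert}$, $\mathrm{box}$, $\mathrm{unbox}$, $\mathrm{setbox}$, and is generated by - $\langle(\lambda_P(x).t)\,v,\sigma\rangle\longrightarrow\langle t[x:=v],\sigma\rangle$; $\langle(\Lambda_P(X<:B).t)[S],\sigma\rangle\longrightarrow\langle t[X:=S],\sigma\rangle$; $\langle(\Lambda_P(Y<:R).t)\{\!\{Q\}\!\},\sigma\rangle\longrightarrow\langle t[Y:=Q],\sigma\rangle$; - if $v$ is tagged $Q$ and $\mathrm{eval}(Q)\sqsubseteq\mathrm{eval}(P)$ (both defined): $\langle\mathrm{upqual}\,P\,v,\sigma\rangle\longrightarrow\langle v\text{ retagged with }P,\sigma\rangle$ and $\langle\mathrm{assert}\,P\,v,\sigma\rangle\longrightarrow\langle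 v,\sigma\rangle$; - if $l\notin\mathrm{dom}\,\sigma$: $\langle\mathrm{box}_P\,v,\sigma\rangle\longrightarrow\langle l_P,\sigma[l\mapsto v]\rangle$; - if $\sigma(l)=v$ is tagged $Q$: $\langle\mathrm{unbox}\,l_P,\sigma\rangle\longrightarrow\langle v\text{ retagged with }P\vee Q,\sigma\rangle$; - if $\mathrm{eval}(P)=\bot$ and $\sigma(l)=w$: $\langle\mathrm{setbox}\,l_P\,v,\sigma\rangle\longrightarrow\langle w,\sigma[l\mapsto v]\rangle$. *Subqualification* $\Gamma\vdash Q<:R$ is generated by $Q<:\top$; $\bot<:Q$; $Y<:Y$; $Y<:R$ if $(Y<:Q)\in\Gamma$ and $Q<:R$; $Q_1\wedge Q_2<:R$ if $Q_1<:R$ or $Q_2<:R$; $Q<:R_1\wedge R_2$ if $Q<:R_1$ and $Q<:R_2$; $Q<:R_1\vee R_2$ if $Q<:R_1$ or $Q<:R_2$; $Q_1\vee Q_2<:R$ if $Q_1<:R$ and $Q_2<:R$. *Subtyping.* $\Gamma\vdash\{Q\}S<:\{Q'\}S'$ if $\Gamma\vdash Q<:Q'$ and $\Gamma\vdash S<:S'$.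 On simple types it is generated by $S<:\top$; $X<:X$; $X<:S$ if $(X<:B)\in\Gamma$ and $B<:S$; $(T_1\to T_2)<:(U_1\to U_2)$ if $U_1<:T_1$ and $T_2<:U_2$; $\forall(X<:B_1).T_1<:\forall(X<:B_2).T_2$ if $\Gamma\vdash B_2<:B_1$ and $\Gamma,X<:B_2\vdash T_1<:T_2$; the same rule for $\forall(Y<:Q).T$; and $\mathrm{box}\,T<:\mathrm{box}\,U$ if $T<:U$ and $U<:T$. *Typing* $\Gamma\mid\Sigma\vdash t:T$ is generated by - $x:T$ if $(x:T)\in\Gamma$; subsumption: $t:U$ if $t:T$ and $\Gamma\vdash T<:U$; - $\lambda_P(x).t:\{P\}(T\to U)$ if $\Gamma,x:T\mid\Sigma\vdash t:U$; $\Lambda_P(X<:B).t:\{P\}\forall(X<:B).T$ if $\Gamma,X<:B\mid\Sigma\vdash t:T$; $\Lambda_P(Y<:Q).t:\{P\}\forall(Y<:Q).T$ if $\Gamma,Y<:Q\mid\Sigma\vdash t:T$; - $s\,t:U$ if $s:\{Q\}(T\to U)$ and $t:T$; $s[S]:T[X:=S]$ if $s:\{Q\}\forall(X<:B).T$ and $\Gamma\vdash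 S<:B$; $s\{\!\{R\}\!\}:T[Y:=R]$ if $s:\{Q\}\forall(Y<:Q').T$ and $\Gamma\vdash R<:Q'$; - $\mathrm{assert}\,P\,s:\{Q\}S$ and $\mathrm{upqual}\,P\,s:\{P\}S$ if $s:\{Q\}S$ and $\Gamma\vdash Q<:P$; - $\mathrm{box}_P\,s:\{P\}\,\mathrm{box}\,T$ if $s:T$; $l_P:\{P\}\,\mathrm{box}\,T$ if $\Sigma(l)=T$; - $\mathrm{unbox}\,s:\{R\vee Q\}S$ if $s:\{R\}\,\mathrm{box}\,\{Q\}S$; $\mathrm{setbox}\,s\,t:T$ if $s:\{\bot\}\,\mathrm{box}\,T$ and $t:T$. The store typing $\Gamma\mid\Sigma\vdash\sigma$ means that $\mathrm{dom}\,\Sigma=\mathrm{dom}\,\sigma$ and $\Gamma\mid\Sigma\vdash\sigma(l):\Sigma(l)$ for every $l\in\mathrm{dom}\,\sigma$. *Claim.* For every context $\Gamma$: suppose $\langle s,\sigma\rangle\longrightarrow\langle t,\sigma'\rangle$. If $\Gamma\mid\Sigma\vdash\sigma$ and $\Gamma\mid\Sigma\vdash s:T$ for some type $T$, then there is an extension $\Sigma'$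 of $\Sigma$ (that is, $\Sigma'(l)=\Sigma(l)$ for every $l\in\mathrm{dom}\,\Sigma$) such that $\Gamma\mid\Sigma'\vdash\sigma'$ and $\Gamma\mid\Sigma'\vdash t:T$. -/

import Mathlib

/-!
Syntax, subtyping, typing and reduction of the calculus F<:M.  Syntax is intrinsically scoped with
de Bruijn indices, in three separate name spaces: `m` term variables, `n` type variables and
`k` qualifier variables.  Every type, bound and context is therefore well formed by construction.
-/

namespace FM

/-- Qualifier expressions: `top` is `readonly`, `bot` is `mutable`. -/
inductive Qual : ℕ → Type
  | top {k : ℕ} : Qual k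
  | bot {k : ℕ} : Qual k
  | var {k : ℕ} (Y : Fin k) : Qual k
  | meet {k : ℕ} (Q R : Qual k) : Qual k
  | join {k : ℕ} (Q R : Qual k) : Qual k

/-- Simple types.  The qualified types `{Q} S` that occur inside a simple type are stored as two
consecutive arguments, a qualifier and a simple type. -/
inductive STy : ℕ → ℕ → Type
  | top {n k : ℕ} : STy n k
  | var {n k : ℕ} (X : Fin n) : STy n k
  /-- `{Q₁} S₁ → {Q₂} S₂` -/
  | arr {n k : ℕ} (Q₁ : Qual k) (S₁ : STy n k) (Q₂ : Qual k) (S₂ : STy n k) : STy n k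
  /-- `∀ (X <: B). {Q} S` -/
  | all {n k : ℕ} (B : STy n k) (Q : Qual k) (S : STy (n + 1) k) : STy n k
  /-- `∀ (Y <: B). {Q} S` -/
  | qall {n k : ℕ} (B : Qual k) (Q : Qual (k + 1)) (S : STy n (k + 1)) : STy n k
  /-- `box ({Q} S)` -/
  | box {n k : ℕ} (Q : Qual k) (S : STy n k) : STy n k

/-- Qualified types `{Q} S`. -/
@[ext]
structure QTy (n k : ℕ) where
  qual : Qual k
  ty : STy n k

/-- The function type `T → U` between qualified types. -/
abbrev STy.arrow {n k : ℕ} (T U : QTy n k) : STy n k := .arr T.qual T.ty U.qual U.ty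

/-- The bounded type quantification `∀ (X <: B). T`. -/
abbrev STy.allT {n k : ℕ} (B : STy n k) (T : QTy (n + 1) k) : STy n k := .all B T.qual T.ty

/-- The bounded qualifier quantification `∀ (Y <: B). T`. -/
abbrev STy.allQ {n k : ℕ} (B : Qual k) (T : QTy n (k + 1)) : STy n k := .qall B T.qual T.ty

/-- The reference type `box T`. -/
abbrev STy.ref {n k : ℕ} (T : QTy n k) : STy n k := .box T.qual T.ty

/-- Terms.  `P` is always the qualifier tag of the value that is introduced. -/
inductive Tm : ℕ → ℕ → ℕ → Type
  | var {m n k : ℕ} (x : Fin m) : Tm m n k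
  /-- `λ_P (x). t`; the argument type is not annotated -/
  | lam {m n k : ℕ} (P : Qual k) (t : Tm (m + 1) n k) : Tm m n k
  /-- `Λ_P (X <: B). t` -/
  | tlam {m n k : ℕ} (P : Qual k) (B : STy n k) (t : Tm m (n + 1) k) : Tm m n k
  /-- `Λ_P (Y <: B). t` -/
  | qlam {m n k : ℕ} (P : Qual k) (B : Qual k) (t : Tm m n (k + 1)) : Tm m n k
  | app {m n k : ℕ} (s t : Tm m n k) : Tm m n k
  | tapp {m n k : ℕ} (s : Tm m n k) (S : STy n k) : Tm m n k
  | qapp {m n k : ℕ} (s : Tm m n k) (Q : Qual k) : Tm m n k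
  | upqual {m n k : ℕ} (P : Qual k) (s : Tm m n k) : Tm m n k
  | assert {m n k : ℕ} (P : Qual k) (s : Tm m n k) : Tm m n k
  /-- creation of a reference cell with tag `P` -/
  | box {m n k : ℕ} (P : Qual k) (s : Tm m n k) : Tm m n k
  /-- a store location, used at tag `P` (a runtime form) -/
  | loc {m n k : ℕ} (P : Qual k) (l : ℕ) : Tm m n k
  | unbox {m n k : ℕ} (s : Tm m n k) : Tm m n k
  | setbox {m n k : ℕ} (s t : Tm m n k) : Tm m n k

/-! ### Renaming -/

/-- Extend a renaming under a binder. -/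
def up {a b : ℕ} (ρ : Fin a → Fin b) : Fin (a + 1) → Fin (b + 1) :=
  Fin.cases 0 (fun i => (ρ i).succ)

def Qual.rename {k k' : ℕ} (ρ : Fin k → Fin k') : Qual k → Qual k'
  | .top => .top
  | .bot => .bot
  | .var Y => .var (ρ Y)
  | .meet Q R => .meet (Q.rename ρ) (R.rename ρ)
  | .join Q R => .join (Q.rename ρ) (R.rename ρ)

def STy.rename {n k n' k' : ℕ} (ρt : Fin n → Fin n') (ρq : Fin k → Fin k') :
    STy n k → STy n' k'
  | .top => .top
  | .var X => .var (ρt X)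
  | .arr Q₁ S₁ Q₂ S₂ =>
      .arr (Q₁.rename ρq) (S₁.rename ρt ρq) (Q₂.rename ρq) (S₂.rename ρt ρq)
  | .all B Q S => .all (B.rename ρt ρq) (Q.rename ρq) (S.rename (up ρt) ρq)
  | .qall B Q S => .qall (B.rename ρq) (Q.rename (up ρq)) (S.rename ρt (up ρq))
  | .box Q S => .box (Q.rename ρq) (S.rename ρt ρq)

def QTy.rename {n k n' k' : ℕ} (ρt : Fin n → Fin n') (ρq : Fin k → Fin k') (T : QTy n k) :
    QTy n' k' :=
  ⟨T.qual.rename ρq, T.ty.rename ρt ρq⟩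

def Tm.rename {m n k m' n' k' : ℕ} (ρ : Fin m → Fin m') (ρt : Fin n → Fin n')
    (ρq : Fin k → Fin k') : Tm m n k → Tm m' n' k'
  | .var x => .var (ρ x)
  | .lam P t => .lam (P.rename ρq) (t.rename (up ρ) ρt ρq)
  | .tlam P B t => .tlam (P.rename ρq) (B.rename ρt ρq) (t.rename ρ (up ρt) ρq)
  | .qlam P B t => .qlam (P.rename ρq) (B.rename ρq) (t.rename ρ ρt (up ρq))
  | .app s t => .app (s.rename ρ ρt ρq) (t.rename ρ ρt ρq)
  | .tapp s S => .tapp (s.rename ρ ρt ρq) (S.rename ρt ρq)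
  | .qapp s Q => .qapp (s.rename ρ ρt ρq) (Q.rename ρq)
  | .upqual P s => .upqual (P.rename ρq) (s.rename ρ ρt ρq)
  | .assert P s => .assert (P.rename ρq) (s.rename ρ ρt ρq)
  | .box P s => .box (P.rename ρq) (s.rename ρ ρt ρq)
  | .loc P l => .loc (P.rename ρq) l
  | .unbox s => .unbox (s.rename ρ ρt ρq)
  | .setbox s t => .setbox (s.rename ρ ρt ρq) (t.rename ρ ρt ρq)

/-! ### Weakening by one fresh variable of a given sort -/

def Qual.wkQ {k : ℕ} (Q : Qual k) : Qual (k + 1) := Q.rename Fin.succ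

def STy.wkT {n k : ℕ} (S : STy n k) : STy (n + 1) k := S.rename Fin.succ id
def STy.wkQ {n k : ℕ} (S : STy n k) : STy n (k + 1) := S.rename id Fin.succ

def QTy.wkT {n k : ℕ} (T : QTy n k) : QTy (n + 1) k := T.rename Fin.succ id
def QTy.wkQ {n k : ℕ} (T : QTy n k) : QTy n (k + 1) := T.rename id Fin.succ

def Tm.wkV {m n k : ℕ} (t : Tm m n k) : Tm (m + 1) n k := t.rename Fin.succ id id
def Tm.wkT {m n k : ℕ} (t : Tm m n k) : Tm m (n + 1) k := t.rename id Fin.succ id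
def Tm.wkQ {m n k : ℕ} (t : Tm m n k) : Tm m n (k + 1) := t.rename id id Fin.succ

/-! ### Simultaneous capture-avoiding substitution -/

/-- Extend a qualifier substitution under a qualifier binder. -/
def upQ {k k' : ℕ} (τ : Fin k → Qual k') : Fin (k + 1) → Qual (k' + 1) :=
  Fin.cases (.var 0) (fun i => (τ i).wkQ)

/-- Extend a type substitution under a type binder. -/
def upT {n n' k' : ℕ} (τ : Fin n → STy n' k') : Fin (n + 1) → STy (n' + 1) k' :=
  Fin.cases (.var 0) (fun i => (τ i).wkT)

/-- Extend a term substitution under a term binder. -/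
def upV {m m' n' k' : ℕ} (τ : Fin m → Tm m' n' k') : Fin (m + 1) → Tm (m' + 1) n' k' :=
  Fin.cases (.var 0) (fun i => (τ i).wkV)

def Qual.subst {k k' : ℕ} (τ : Fin k → Qual k') : Qual k → Qual k'
  | .top => .top
  | .bot => .bot
  | .var Y => τ Y
  | .meet Q R => .meet (Q.subst τ) (R.subst τ)
  | .join Q R => .join (Q.subst τ) (R.subst τ)

def STy.subst {n k n' k' : ℕ} (τt : Fin n → STy n' k') (τq : Fin k → Qual k') :
    STy n k → STy n' k'
  | .top => .top
  | .var X => τt X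
  | .arr Q₁ S₁ Q₂ S₂ =>
      .arr (Q₁.subst τq) (S₁.subst τt τq) (Q₂.subst τq) (S₂.subst τt τq)
  | .all B Q S => .all (B.subst τt τq) (Q.subst τq) (S.subst (upT τt) τq)
  | .qall B Q S =>
      .qall (B.subst τq) (Q.subst (upQ τq)) (S.subst (fun i => (τt i).wkQ) (upQ τq))
  | .box Q S => .box (Q.subst τq) (S.subst τt τq)

def QTy.subst {n k n' k' : ℕ} (τt : Fin n → STy n' k') (τq : Fin k → Qual k') (T : QTy n k) :
    QTy n' k' :=
  ⟨T.qual.subst τq, T.ty.subst τt τq⟩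

def Tm.subst {m n k m' n' k' : ℕ} (τ : Fin m → Tm m' n' k') (τt : Fin n → STy n' k')
    (τq : Fin k → Qual k') : Tm m n k → Tm m' n' k'
  | .var x => τ x
  | .lam P t => .lam (P.subst τq) (t.subst (upV τ) τt τq)
  | .tlam P B t =>
      .tlam (P.subst τq) (B.subst τt τq) (t.subst (fun i => (τ i).wkT) (upT τt) τq)
  | .qlam P B t =>
      .qlam (P.subst τq) (B.subst τq)
        (t.subst (fun i => (τ i).wkQ) (fun i => (τt i).wkQ) (upQ τq))
  | .app s t => .app (s.subst τ τt τq) (t.subst τ τt τq)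
  | .tapp s S => .tapp (s.subst τ τt τq) (S.subst τt τq)
  | .qapp s Q => .qapp (s.subst τ τt τq) (Q.subst τq)
  | .upqual P s => .upqual (P.subst τq) (s.subst τ τt τq)
  | .assert P s => .assert (P.subst τq) (s.subst τ τt τq)
  | .box P s => .box (P.subst τq) (s.subst τ τt τq)
  | .loc P l => .loc (P.subst τq) l
  | .unbox s => .unbox (s.subst τ τt τq)
  | .setbox s t => .setbox (s.subst τ τt τq) (t.subst τ τt τq)

/-! ### Substitution for the most recently bound variable -/

/-- `T[X := S]` -/
def QTy.instT {n k : ℕ} (T : QTy (n + 1) k) (S : STy n k) : QTy n k :=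
  T.subst (Fin.cases S STy.var) Qual.var

/-- `T[Y := Q]` -/
def QTy.instQ {n k : ℕ} (T : QTy n (k + 1)) (Q : Qual k) : QTy n k :=
  T.subst STy.var (Fin.cases Q Qual.var)

/-- `t[x := s]` -/
def Tm.instV {m n k : ℕ} (t : Tm (m + 1) n k) (s : Tm m n k) : Tm m n k :=
  t.subst (Fin.cases s Tm.var) STy.var Qual.var

/-- `t[X := S]` -/
def Tm.instT {m n k : ℕ} (t : Tm m (n + 1) k) (S : STy n k) : Tm m n k :=
  t.subst Tm.var (Fin.cases S STy.var) Qual.var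

/-- `t[Y := Q]` -/
def Tm.instQ {m n k : ℕ} (t : Tm m n (k + 1)) (Q : Qual k) : Tm m n k :=
  t.subst Tm.var STy.var (Fin.cases Q Qual.var)

/-! ### Values, tags and evaluation of qualifier expressions -/

inductive IsValue {m n k : ℕ} : Tm m n k → Prop
  | lam (P : Qual k) (t : Tm (m + 1) n k) : IsValue (.lam P t)
  | tlam (P : Qual k) (B : STy n k) (t : Tm m (n + 1) k) : IsValue (.tlam P B t)
  | qlam (P : Qual k) (B : Qual k) (t : Tm m n (k + 1)) : IsValue (.qlam P B t)
  | loc (P : Qual k) (l : ℕ) : IsValue (.loc P l)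

/-- `HasTag v Q`: the value `v` is tagged with `Q`. -/
inductive HasTag {m n k : ℕ} : Tm m n k → Qual k → Prop
  | lam (P : Qual k) (t : Tm (m + 1) n k) : HasTag (.lam P t) P
  | tlam (P : Qual k) (B : STy n k) (t : Tm m (n + 1) k) : HasTag (.tlam P B t) P
  | qlam (P : Qual k) (B : Qual k) (t : Tm m n (k + 1)) : HasTag (.qlam P B t) P
  | loc (P : Qual k) (l : ℕ) : HasTag (.loc P l) P

/-- Replace the tag of a value by `P` (only ever applied to values). -/
def Tm.retag {m n k : ℕ} (P : Qual k) : Tm m n k → Tm m n k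
  | .lam _ t => .lam P t
  | .tlam _ B t => .tlam P B t
  | .qlam _ B t => .qlam P B t
  | .loc _ l => .loc P l
  | t => t

/-- The concrete qualifier that a qualifier expression denotes, in the two-point lattice
`Bool` (`⊥ = false` is `mutable`, `⊤ = true` is `readonly`); undefined if it contains variables. -/
def Qual.eval {k : ℕ} : Qual k → Option Bool
  | .top => some ⊤
  | .bot => some ⊥
  | .var _ => none
  | .meet Q R => Q.eval.bind fun a => R.eval.map fun b => a ⊓ b
  | .join Q R => Q.eval.bind fun a => R.eval.map fun b => a ⊔ b

/-! ### Stores and reduction -/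

abbrev Val (m n k : ℕ) : Type := {v : Tm m n k // IsValue v}

/-- A store is a finite partial map from locations to values. -/
abbrev Store (m n k : ℕ) : Type := Finmap (fun _ : ℕ => Val m n k)

/-- Call-by-value reduction `⟨s, σ⟩ ⟶ ⟨t, σ'⟩`. -/
inductive Step {m n k : ℕ} : Tm m n k → Store m n k → Tm m n k → Store m n k → Prop
  | beta_v {P : Qual k} {t : Tm (m + 1) n k} {v : Tm m n k} {σ : Store m n k} :
      IsValue v → Step (.app (.lam P t) v) σ (t.instV v) σ
  | beta_T {P : Qual k} {B : STy n k} {t : Tm m (n + 1) k} {S : STy n k} {σ : Store m n k} :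
      Step (.tapp (.tlam P B t) S) σ (t.instT S) σ
  | beta_Q {P : Qual k} {B : Qual k} {t : Tm m n (k + 1)} {Q : Qual k} {σ : Store m n k} :
      Step (.qapp (.qlam P B t) Q) σ (t.instQ Q) σ
  | upqual {P Q : Qual k} {v : Tm m n k} {a b : Bool} {σ : Store m n k} :
      IsValue v → HasTag v Q → Q.eval = some a → P.eval = some b → a ≤ b →
      Step (.upqual P v) σ (v.retag P) σ
  | assert {P Q : Qual k} {v : Tm m n k} {a b : Bool} {σ : Store m n k} :
      IsValue v → HasTag v Q → Q.eval = some a → P.eval = some b → a ≤ b →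
      Step (.assert P v) σ v σ
  /-- allocation at any fresh location -/
  | ref {P : Qual k} {v : Val m n k} {l : ℕ} {σ : Store m n k} :
      l ∉ σ → Step (.box P v.1) σ (.loc P l) (σ.insert l v)
  /-- the value read is retagged with the join of its own tag and the tag of the reference -/
  | deref {P Q : Qual k} {v : Val m n k} {l : ℕ} {σ : Store m n k} :
      σ.lookup l = some v → HasTag v.1 Q →
      Step (.unbox (.loc P l)) σ (v.1.retag (.join P Q)) σ
  /-- writing needs a reference whose tag evaluates to `mutable`, and returns the old value -/
  | update {P : Qual k} {v w : Val m n k} {l : ℕ} {σ : Store m n k} :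
      P.eval = some ⊥ → σ.lookup l = some w →
      Step (.setbox (.loc P l) v.1) σ w.1 (σ.insert l v)
  | app_left {s s' t : Tm m n k} {σ σ' : Store m n k} :
      Step s σ s' σ' → Step (.app s t) σ (.app s' t) σ'
  | app_right {v t t' : Tm m n k} {σ σ' : Store m n k} :
      IsValue v → Step t σ t' σ' → Step (.app v t) σ (.app v t') σ'
  | tapp_fun {s s' : Tm m n k} {S : STy n k} {σ σ' : Store m n k} :
      Step s σ s' σ' → Step (.tapp s S) σ (.tapp s' S) σ'
  | qapp_fun {s s' : Tm m n k} {Q : Qual k} {σ σ' : Store m n k} :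
      Step s σ s' σ' → Step (.qapp s Q) σ (.qapp s' Q) σ'
  | upqual_arg {P : Qual k} {s s' : Tm m n k} {σ σ' : Store m n k} :
      Step s σ s' σ' → Step (.upqual P s) σ (.upqual P s') σ'
  | assert_arg {P : Qual k} {s s' : Tm m n k} {σ σ' : Store m n k} :
      Step s σ s' σ' → Step (.assert P s) σ (.assert P s') σ'
  | box_arg {P : Qual k} {s s' : Tm m n k} {σ σ' : Store m n k} :
      Step s σ s' σ' → Step (.box P s) σ (.box P s') σ'
  | unbox_arg {s s' : Tm m n k} {σ σ' : Store m n k} :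
      Step s σ s' σ' → Step (.unbox s) σ (.unbox s') σ'
  | setbox_left {s s' t : Tm m n k} {σ σ' : Store m n k} :
      Step s σ s' σ' → Step (.setbox s t) σ (.setbox s' t) σ'
  | setbox_right {v t t' : Tm m n k} {σ σ' : Store m n k} :
      IsValue v → Step t σ t' σ' → Step (.setbox v t) σ (.setbox v t') σ'

/-! ### Contexts -/

/-- Typing contexts `Γ`: telescopes of bindings `x : T`, `X <: S` and `Y <: Q`. -/
inductive Ctx : ℕ → ℕ → ℕ → Type
  | nil : Ctx 0 0 0
  | consV {m n k : ℕ} (Γ : Ctx m n k) (T : QTy n k) : Ctx (m + 1) n k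
  | consT {m n k : ℕ} (Γ : Ctx m n k) (B : STy n k) : Ctx m (n + 1) k
  | consQ {m n k : ℕ} (Γ : Ctx m n k) (B : Qual k) : Ctx m n (k + 1)

/-- The type of a term variable, as a type over the whole context. -/
def Ctx.typeOf {m n k : ℕ} : Ctx m n k → Fin m → QTy n k
  | .nil => fun x => x.elim0
  | .consV Γ T => Fin.cases T Γ.typeOf
  | .consT Γ _ => fun x => (Γ.typeOf x).wkT
  | .consQ Γ _ => fun x => (Γ.typeOf x).wkQ

/-- The bound of a type variable, as a simple type over the whole context. -/
def Ctx.boundT {m n k : ℕ} : Ctx m n k → Fin n → STy n k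
  | .nil => fun X => X.elim0
  | .consV Γ _ => Γ.boundT
  | .consT Γ B => Fin.cases B.wkT (fun X => (Γ.boundT X).wkT)
  | .consQ Γ _ => fun X => (Γ.boundT X).wkQ

/-- The bound of a qualifier variable, as a qualifier over the whole context. -/
def Ctx.boundQ {m n k : ℕ} : Ctx m n k → Fin k → Qual k
  | .nil => fun Y => Y.elim0
  | .consV Γ _ => Γ.boundQ
  | .consT Γ _ => Γ.boundQ
  | .consQ Γ B => Fin.cases B.wkQ (fun Y => (Γ.boundQ Y).wkQ)

/-! ### Subqualification and subtyping -/

/-- Subqualification `Γ ⊢ Q <: R`. -/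
inductive SubQual {m n k : ℕ} (Γ : Ctx m n k) : Qual k → Qual k → Prop
  | top {Q : Qual k} : SubQual Γ Q .top
  | bot {Q : Qual k} : SubQual Γ .bot Q
  | refl_var {Y : Fin k} : SubQual Γ (.var Y) (.var Y)
  | var {Y : Fin k} {Q : Qual k} : SubQual Γ (Γ.boundQ Y) Q → SubQual Γ (.var Y) Q
  | meet_elim_1 {Q₁ Q₂ R : Qual k} : SubQual Γ Q₁ R → SubQual Γ (.meet Q₁ Q₂) R
  | meet_elim_2 {Q₁ Q₂ R : Qual k} : SubQual Γ Q₂ R → SubQual Γ (.meet Q₁ Q₂) R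
  | meet_intro {Q R₁ R₂ : Qual k} :
      SubQual Γ Q R₁ → SubQual Γ Q R₂ → SubQual Γ Q (.meet R₁ R₂)
  | join_intro_1 {Q R₁ R₂ : Qual k} : SubQual Γ Q R₁ → SubQual Γ Q (.join R₁ R₂)
  | join_intro_2 {Q R₁ R₂ : Qual k} : SubQual Γ Q R₂ → SubQual Γ Q (.join R₁ R₂)
  | join_elim {Q₁ Q₂ R : Qual k} :
      SubQual Γ Q₁ R → SubQual Γ Q₂ R → SubQual Γ (.join Q₁ Q₂) R

/-- Subtyping `Γ ⊢ S <: S'` of simple types, with the full rule for bounded quantifiers.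
Premises on qualified types `{Q} S <: {Q'} S'` are spelled out as `Q <: Q'` and `S <: S'`. -/
inductive SubS : {m n k : ℕ} → Ctx m n k → STy n k → STy n k → Prop
  | top {m n k : ℕ} {Γ : Ctx m n k} {S : STy n k} : SubS Γ S .top
  | refl_var {m n k : ℕ} {Γ : Ctx m n k} {X : Fin n} : SubS Γ (.var X) (.var X)
  | var {m n k : ℕ} {Γ : Ctx m n k} {X : Fin n} {S : STy n k} :
      SubS Γ (Γ.boundT X) S → SubS Γ (.var X) S
  | arr {m n k : ℕ} {Γ : Ctx m n k} {Q₁ Q₂ R₁ R₂ : Qual k} {S₁ S₂ U₁ U₂ : STy n k} :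
      SubQual Γ R₁ Q₁ → SubS Γ U₁ S₁ → SubQual Γ Q₂ R₂ → SubS Γ S₂ U₂ →
      SubS Γ (.arr Q₁ S₁ Q₂ S₂) (.arr R₁ U₁ R₂ U₂)
  | all {m n k : ℕ} {Γ : Ctx m n k} {B₁ B₂ : STy n k} {Q₁ Q₂ : Qual k}
      {S₁ S₂ : STy (n + 1) k} :
      SubS Γ B₂ B₁ → SubQual (Γ.consT B₂) Q₁ Q₂ → SubS (Γ.consT B₂) S₁ S₂ →
      SubS Γ (.all B₁ Q₁ S₁) (.all B₂ Q₂ S₂)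
  | qall {m n k : ℕ} {Γ : Ctx m n k} {B₁ B₂ : Qual k} {Q₁ Q₂ : Qual (k + 1)}
      {S₁ S₂ : STy n (k + 1)} :
      SubQual Γ B₂ B₁ → SubQual (Γ.consQ B₂) Q₁ Q₂ → SubS (Γ.consQ B₂) S₁ S₂ →
      SubS Γ (.qall B₁ Q₁ S₁) (.qall B₂ Q₂ S₂)
  /-- references are invariant -/
  | box {m n k : ℕ} {Γ : Ctx m n k} {Q₁ Q₂ : Qual k} {S₁ S₂ : STy n k} :
      SubQual Γ Q₁ Q₂ → SubQual Γ Q₂ Q₁ → SubS Γ S₁ S₂ → SubS Γ S₂ S₁ →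
      SubS Γ (.box Q₁ S₁) (.box Q₂ S₂)

/-- Subtyping of qualified types: `{Q} S <: {Q'} S'` iff `Q <: Q'` and `S <: S'`. -/
def SubT {m n k : ℕ} (Γ : Ctx m n k) (T U : QTy n k) : Prop :=
  SubQual Γ T.qual U.qual ∧ SubS Γ T.ty U.ty

/-! ### Store environments and typing -/

/-- Store environments `Σ`: partial maps from locations to qualified types in the scope of `Γ`. -/
def StoreEnv (n k : ℕ) : Type := ℕ → Option (QTy n k)

def StoreEnv.wkT {n k : ℕ} (E : StoreEnv n k) : StoreEnv (n + 1) k := fun l => (E l).map QTy.wkT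
def StoreEnv.wkQ {n k : ℕ} (E : StoreEnv n k) : StoreEnv n (k + 1) := fun l => (E l).map QTy.wkQ

/-- `E'.Extends E`: `E'` agrees with `E` on the domain of `E`. -/
def StoreEnv.Extends {n k : ℕ} (E' E : StoreEnv n k) : Prop :=
  ∀ (l : ℕ) (T : QTy n k), E l = some T → E' l = some T

/-- Typing `Γ | Σ ⊢ t : T`. -/
inductive HasType : {m n k : ℕ} → Ctx m n k → StoreEnv n k → Tm m n k → QTy n k → Prop
  | var {m n k : ℕ} {Γ : Ctx m n k} {E : StoreEnv n k} {x : Fin m} :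
      HasType Γ E (.var x) (Γ.typeOf x)
  | abs {m n k : ℕ} {Γ : Ctx m n k} {E : StoreEnv n k} {P : Qual k} {T U : QTy n k}
      {t : Tm (m + 1) n k} :
      HasType (Γ.consV T) E t U → HasType Γ E (.lam P t) ⟨P, .arrow T U⟩
  | t_abs {m n k : ℕ} {Γ : Ctx m n k} {E : StoreEnv n k} {P : Qual k} {B : STy n k}
      {T : QTy (n + 1) k} {t : Tm m (n + 1) k} :
      HasType (Γ.consT B) E.wkT t T → HasType Γ E (.tlam P B t) ⟨P, .allT B T⟩
  | q_abs {m n k : ℕ} {Γ : Ctx m n k} {E : StoreEnv n k} {P : Qual k} {B : Qual k}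
      {T : QTy n (k + 1)} {t : Tm m n (k + 1)} :
      HasType (Γ.consQ B) E.wkQ t T → HasType Γ E (.qlam P B t) ⟨P, .allQ B T⟩
  | app {m n k : ℕ} {Γ : Ctx m n k} {E : StoreEnv n k} {Q : Qual k} {T U : QTy n k}
      {s t : Tm m n k} :
      HasType Γ E s ⟨Q, .arrow T U⟩ → HasType Γ E t T → HasType Γ E (.app s t) U
  | t_app {m n k : ℕ} {Γ : Ctx m n k} {E : StoreEnv n k} {Q : Qual k} {B S : STy n k}
      {T : QTy (n + 1) k} {s : Tm m n k} :
      HasType Γ E s ⟨Q, .allT B T⟩ → SubS Γ S B → HasType Γ E (.tapp s S) (T.instT S)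
  | q_app {m n k : ℕ} {Γ : Ctx m n k} {E : StoreEnv n k} {Q B R : Qual k}
      {T : QTy n (k + 1)} {s : Tm m n k} :
      HasType Γ E s ⟨Q, .allQ B T⟩ → SubQual Γ R B → HasType Γ E (.qapp s R) (T.instQ R)
  | sub {m n k : ℕ} {Γ : Ctx m n k} {E : StoreEnv n k} {T U : QTy n k} {s : Tm m n k} :
      HasType Γ E s T → SubT Γ T U → HasType Γ E s U
  | typ_assert {m n k : ℕ} {Γ : Ctx m n k} {E : StoreEnv n k} {P Q : Qual k} {S : STy n k}
      {s : Tm m n k} :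
      HasType Γ E s ⟨Q, S⟩ → SubQual Γ Q P → HasType Γ E (.assert P s) ⟨Q, S⟩
  | typ_upqual {m n k : ℕ} {Γ : Ctx m n k} {E : StoreEnv n k} {P Q : Qual k} {S : STy n k}
      {s : Tm m n k} :
      HasType Γ E s ⟨Q, S⟩ → SubQual Γ Q P → HasType Γ E (.upqual P s) ⟨P, S⟩
  | ref_intro {m n k : ℕ} {Γ : Ctx m n k} {E : StoreEnv n k} {P : Qual k} {T : QTy n k}
      {s : Tm m n k} :
      HasType Γ E s T → HasType Γ E (.box P s) ⟨P, .ref T⟩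
  | loc {m n k : ℕ} {Γ : Ctx m n k} {E : StoreEnv n k} {P : Qual k} {T : QTy n k} {l : ℕ} :
      E l = some T → HasType Γ E (.loc P l) ⟨P, .ref T⟩
  | ref_elim {m n k : ℕ} {Γ : Ctx m n k} {E : StoreEnv n k} {R Q : Qual k} {S : STy n k}
      {s : Tm m n k} :
      HasType Γ E s ⟨R, .ref ⟨Q, S⟩⟩ → HasType Γ E (.unbox s) ⟨.join R Q, S⟩
  | ref_update {m n k : ℕ} {Γ : Ctx m n k} {E : StoreEnv n k} {T : QTy n k}
      {s t : Tm m n k} :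
      HasType Γ E s ⟨.bot, .ref T⟩ → HasType Γ E t T → HasType Γ E (.setbox s t) T

/-- Store typing `Γ | Σ ⊢ σ`: `Σ` and `σ` have the same domain, and the value stored at each
location has the type that `Σ` assigns to it. -/
def StoreTyped {m n k : ℕ} (Γ : Ctx m n k) (E : StoreEnv n k) (σ : Store m n k) : Prop :=
  (∀ l : ℕ, (E l).isSome ↔ l ∈ σ) ∧
    ∀ (l : ℕ) (v : Val m n k) (T : QTy n k),
      σ.lookup l = some v → E l = some T → HasType Γ E v.1 T

end FM

/-!
Preservation is proved by induction on the typing derivation, subsumption being the only rule that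
is not syntax directed.  Each redex is typed by inverting the typing of the value it eliminates and
by a substitution lemma, which needs subtyping to be transitive.

Under full subtyping of bounded quantifiers, transitivity and narrowing depend on each other:
transitivity through `∀ (X <: B). T` narrows the bound of `X` in a derivation about `T`, and
narrowing a bound `B` composes derivations through `B`.  An induction on the size of the middle type
unties the knot.  Qualifier bounds cause no such circularity, because transitivity of
subqualification does not involve the context being changed.
-/

namespace FM

/-! ### Composition of renamings and substitutions -/

section Composition

variable {a b c k l r : ℕ}

theorem up_id : up (id : Fin a → Fin a) = id :=
  funext (Fin.cases rfl fun _ => rfl)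

theorem up_up (ρ' : Fin b → Fin c) (ρ : Fin a → Fin b) :
    (fun i => up ρ' (up ρ i)) = up (fun i => ρ' (ρ i)) :=
  funext (Fin.cases rfl fun _ => rfl)

theorem up_succ (ρ : Fin a → Fin b) (i : Fin a) : up ρ i.succ = (ρ i).succ :=
  rfl

theorem Qual.rename_id (Q : Qual k) : Q.rename id = Q := by
  induction Q <;> simp_all [Qual.rename]

theorem Qual.rename_rename (ρ' : Fin l → Fin r) (ρ : Fin k → Fin l) (Q : Qual k) :
    (Q.rename ρ).rename ρ' = Q.rename (fun i => ρ' (ρ i)) := by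
  induction Q <;> simp_all [Qual.rename]

theorem Qual.subst_var (Q : Qual k) : Q.subst Qual.var = Q := by
  induction Q <;> simp_all [Qual.subst]

theorem Qual.rename_eq_subst (ρ : Fin k → Fin l) (Q : Qual k) :
    Q.rename ρ = Q.subst (fun i => .var (ρ i)) := by
  induction Q <;> simp_all [Qual.rename, Qual.subst]

theorem Qual.subst_subst (τ' : Fin l → Qual r) (τ : Fin k → Qual l) (Q : Qual k) :
    (Q.subst τ).subst τ' = Q.subst (fun i => (τ i).subst τ') := by
  induction Q <;> simp_all [Qual.subst]

theorem Qual.subst_rename (τ : Fin l → Qual r) (ρ : Fin k → Fin l) (Q : Qual k) :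
    (Q.rename ρ).subst τ = Q.subst (fun i => τ (ρ i)) := by
  simp only [Qual.rename_eq_subst, Qual.subst_subst, Qual.subst]

theorem Qual.rename_subst (ρ : Fin l → Fin r) (τ : Fin k → Qual l) (Q : Qual k) :
    (Q.subst τ).rename ρ = Q.subst (fun i => (τ i).rename ρ) := by
  simp only [Qual.rename_eq_subst, Qual.subst_subst]

theorem Qual.rename_wkQ (ρ : Fin k → Fin l) (Q : Qual k) :
    Q.wkQ.rename (up ρ) = (Q.rename ρ).wkQ := by
  simp only [Qual.wkQ, Qual.rename_rename, up_succ]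

theorem Qual.subst_wkQ (τ : Fin k → Qual l) (Q : Qual k) :
    Q.wkQ.subst (upQ τ) = (Q.subst τ).wkQ := by
  simp only [Qual.wkQ, Qual.rename_subst, Qual.subst_rename, upQ, Fin.cases_succ]

theorem Qual.subst_cases_wkQ (R Q : Qual k) : R.wkQ.subst (Fin.cases Q Qual.var) = R := by
  simp only [Qual.wkQ, Qual.subst_rename, Fin.cases_succ, Qual.subst_var]

theorem upQ_var : upQ (Qual.var : Fin k → Qual k) = Qual.var :=
  funext (Fin.cases rfl fun _ => rfl)

theorem upQ_up (τ : Fin l → Qual r) (ρ : Fin k → Fin l) :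
    (fun i => upQ τ (up ρ i)) = upQ (fun i => τ (ρ i)) :=
  funext (Fin.cases rfl fun _ => rfl)

theorem rename_upQ (ρ : Fin l → Fin r) (τ : Fin k → Qual l) :
    (fun i => (upQ τ i).rename (up ρ)) = upQ (fun i => (τ i).rename ρ) :=
  funext (Fin.cases rfl fun _ => Qual.rename_wkQ _ _)

theorem subst_upQ (τ' : Fin l → Qual r) (τ : Fin k → Qual l) :
    (fun i => (upQ τ i).subst (upQ τ')) = upQ (fun i => (τ i).subst τ') :=
  funext (Fin.cases rfl fun _ => Qual.subst_wkQ _ _)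

theorem STy.rename_id (S : STy a k) : S.rename id id = S := by
  induction S <;> simp_all [STy.rename, Qual.rename_id, up_id]

theorem STy.rename_rename (ρt' : Fin b → Fin c) (ρt : Fin a → Fin b) (ρq' : Fin l → Fin r)
    (ρq : Fin k → Fin l) (S : STy a k) :
    (S.rename ρt ρq).rename ρt' ρq' =
      S.rename (fun i => ρt' (ρt i)) (fun i => ρq' (ρq i)) := by
  induction S generalizing b c l r <;> simp_all [STy.rename, Qual.rename_rename, up_up]

theorem STy.rename_wkT (ρt : Fin a → Fin b) (ρq : Fin k → Fin l) (S : STy a k) :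
    S.wkT.rename (up ρt) ρq = (S.rename ρt ρq).wkT := by
  simp only [STy.wkT, STy.rename_rename, up_succ, id]

theorem STy.rename_wkQ (ρt : Fin a → Fin b) (ρq : Fin k → Fin l) (S : STy a k) :
    S.wkQ.rename ρt (up ρq) = (S.rename ρt ρq).wkQ := by
  simp only [STy.wkQ, STy.rename_rename, up_succ, id]

theorem upT_var : upT (STy.var : Fin a → STy a k) = STy.var :=
  funext (Fin.cases rfl fun _ => rfl)

theorem upT_up (τt : Fin b → STy c k) (ρt : Fin a → Fin b) :
    (fun i => upT τt (up ρt i)) = upT (fun i => τt (ρt i)) :=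
  funext (Fin.cases rfl fun _ => rfl)

theorem rename_upT (ρt : Fin b → Fin c) (ρq : Fin k → Fin l) (τt : Fin a → STy b k) :
    (fun i => (upT τt i).rename (up ρt) ρq) = upT (fun i => (τt i).rename ρt ρq) :=
  funext (Fin.cases rfl fun _ => STy.rename_wkT _ _ _)

theorem STy.subst_var (S : STy a k) : S.subst STy.var Qual.var = S := by
  induction S <;> simp_all [STy.subst, Qual.subst_var, upT_var, upQ_var, STy.wkQ, STy.rename]

theorem STy.subst_rename (τt : Fin b → STy c r) (ρt : Fin a → Fin b) (τq : Fin l → Qual r)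
    (ρq : Fin k → Fin l) (S : STy a k) :
    (S.rename ρt ρq).subst τt τq = S.subst (fun i => τt (ρt i)) (fun i => τq (ρq i)) := by
  induction S generalizing b c l r <;>
    simp_all [STy.rename, STy.subst, Qual.subst_rename, upT_up, upQ_up]

theorem STy.rename_subst (ρt : Fin b → Fin c) (τt : Fin a → STy b l) (ρq : Fin l → Fin r)
    (τq : Fin k → Qual l) (S : STy a k) :
    (S.subst τt τq).rename ρt ρq =
      S.subst (fun i => (τt i).rename ρt ρq) (fun i => (τq i).rename ρq) := by
  induction S generalizing b c l r <;>
    simp_all [STy.rename, STy.subst, Qual.rename_subst, rename_upT, rename_upQ, STy.rename_wkQ]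

theorem STy.subst_wkT (τt : Fin a → STy b l) (τq : Fin k → Qual l) (S : STy a k) :
    S.wkT.subst (upT τt) τq = (S.subst τt τq).wkT := by
  simp only [STy.wkT, STy.rename_subst, STy.subst_rename, upT, Fin.cases_succ, Qual.rename_id, id]

theorem STy.subst_wkQ (τt : Fin a → STy b l) (τq : Fin k → Qual l) (S : STy a k) :
    S.wkQ.subst (fun i => (τt i).wkQ) (upQ τq) = (S.subst τt τq).wkQ := by
  simp only [STy.wkQ, STy.rename_subst, STy.subst_rename, upQ, Fin.cases_succ, Qual.wkQ, id]

theorem subst_upT (τt' : Fin b → STy c l) (τq : Fin k → Qual l) (τt : Fin a → STy b k) :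
    (fun i => (upT τt i).subst (upT τt') τq) = upT (fun i => (τt i).subst τt' τq) :=
  funext (Fin.cases rfl fun _ => STy.subst_wkT _ _ _)

theorem STy.subst_subst (τt' : Fin b → STy c r) (τt : Fin a → STy b l) (τq' : Fin l → Qual r)
    (τq : Fin k → Qual l) (S : STy a k) :
    (S.subst τt τq).subst τt' τq' =
      S.subst (fun i => (τt i).subst τt' τq') (fun i => (τq i).subst τq') := by
  induction S generalizing b c l r <;>
    simp_all [STy.subst, Qual.subst_subst, subst_upT, subst_upQ, STy.subst_wkQ]

theorem STy.subst_cases_wkT (S U : STy a k) :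
    S.wkT.subst (Fin.cases U STy.var) Qual.var = S := by
  simp only [STy.wkT, STy.subst_rename, Fin.cases_succ, id, STy.subst_var]

theorem STy.subst_cases_wkQ (S : STy a k) (Q : Qual k) :
    S.wkQ.subst STy.var (Fin.cases Q Qual.var) = S := by
  simp only [STy.wkQ, STy.subst_rename, Fin.cases_succ, id, STy.subst_var]

theorem QTy.rename_id (T : QTy a k) : T.rename id id = T :=
  QTy.ext (Qual.rename_id _) (STy.rename_id _)

theorem QTy.subst_var (T : QTy a k) : T.subst STy.var Qual.var = T :=
  QTy.ext (Qual.subst_var _) (STy.subst_var _)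

theorem QTy.rename_rename (ρt' : Fin b → Fin c) (ρt : Fin a → Fin b) (ρq' : Fin l → Fin r)
    (ρq : Fin k → Fin l) (T : QTy a k) :
    (T.rename ρt ρq).rename ρt' ρq' =
      T.rename (fun i => ρt' (ρt i)) (fun i => ρq' (ρq i)) :=
  QTy.ext (Qual.rename_rename _ _ _) (STy.rename_rename _ _ _ _ _)

theorem QTy.subst_rename (τt : Fin b → STy c r) (ρt : Fin a → Fin b) (τq : Fin l → Qual r)
    (ρq : Fin k → Fin l) (T : QTy a k) :
    (T.rename ρt ρq).subst τt τq = T.subst (fun i => τt (ρt i)) (fun i => τq (ρq i)) :=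
  QTy.ext (Qual.subst_rename _ _ _) (STy.subst_rename _ _ _ _ _)

theorem QTy.rename_subst (ρt : Fin b → Fin c) (τt : Fin a → STy b l) (ρq : Fin l → Fin r)
    (τq : Fin k → Qual l) (T : QTy a k) :
    (T.subst τt τq).rename ρt ρq =
      T.subst (fun i => (τt i).rename ρt ρq) (fun i => (τq i).rename ρq) :=
  QTy.ext (Qual.rename_subst _ _ _) (STy.rename_subst _ _ _ _ _)

theorem QTy.subst_subst (τt' : Fin b → STy c r) (τt : Fin a → STy b l) (τq' : Fin l → Qual r)
    (τq : Fin k → Qual l) (T : QTy a k) :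
    (T.subst τt τq).subst τt' τq' =
      T.subst (fun i => (τt i).subst τt' τq') (fun i => (τq i).subst τq') :=
  QTy.ext (Qual.subst_subst _ _ _) (STy.subst_subst _ _ _ _ _)

theorem QTy.rename_wkT (ρt : Fin a → Fin b) (ρq : Fin k → Fin l) (T : QTy a k) :
    T.wkT.rename (up ρt) ρq = (T.rename ρt ρq).wkT := by
  simp only [QTy.wkT, QTy.rename_rename, up_succ, id]

theorem QTy.rename_wkQ (ρt : Fin a → Fin b) (ρq : Fin k → Fin l) (T : QTy a k) :
    T.wkQ.rename ρt (up ρq) = (T.rename ρt ρq).wkQ := by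
  simp only [QTy.wkQ, QTy.rename_rename, up_succ, id]

theorem QTy.subst_wkT (τt : Fin a → STy b l) (τq : Fin k → Qual l) (T : QTy a k) :
    T.wkT.subst (upT τt) τq = (T.subst τt τq).wkT := by
  simp only [QTy.wkT, QTy.rename_subst, QTy.subst_rename, upT, Fin.cases_succ, STy.wkT,
    Qual.rename_id, id]

theorem QTy.subst_wkQ (τt : Fin a → STy b l) (τq : Fin k → Qual l) (T : QTy a k) :
    T.wkQ.subst (fun i => (τt i).wkQ) (upQ τq) = (T.subst τt τq).wkQ :=
  QTy.ext (Qual.subst_wkQ _ _) (STy.subst_wkQ _ _ _)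

theorem QTy.wkT_instT (T : QTy a k) (S : STy a k) : T.wkT.instT S = T := by
  simp only [QTy.instT, QTy.wkT, QTy.subst_rename, Fin.cases_succ, id, QTy.subst_var]

theorem QTy.wkQ_instQ (T : QTy a k) (Q : Qual k) : T.wkQ.instQ Q = T := by
  simp only [QTy.instQ, QTy.wkQ, QTy.subst_rename, Fin.cases_succ, id, QTy.subst_var]

theorem QTy.rename_instT (ρt : Fin a → Fin b) (ρq : Fin k → Fin l) (T : QTy (a + 1) k)
    (S : STy a k) :
    (T.instT S).rename ρt ρq = (T.rename (up ρt) ρq).instT (S.rename ρt ρq) := by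
  simp only [QTy.instT, QTy.rename_subst, QTy.subst_rename]
  exact congrArg (T.subst · _) (funext (Fin.cases rfl fun _ => rfl))

theorem QTy.rename_instQ (ρt : Fin a → Fin b) (ρq : Fin k → Fin l) (T : QTy a (k + 1))
    (Q : Qual k) :
    (T.instQ Q).rename ρt ρq = (T.rename ρt (up ρq)).instQ (Q.rename ρq) := by
  simp only [QTy.instQ, QTy.rename_subst, QTy.subst_rename]
  exact congrArg (T.subst _ ·) (funext (Fin.cases rfl fun _ => rfl))

theorem QTy.subst_instT (τt : Fin a → STy b l) (τq : Fin k → Qual l) (T : QTy (a + 1) k)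
    (S : STy a k) :
    (T.instT S).subst τt τq = (T.subst (upT τt) τq).instT (S.subst τt τq) := by
  simp only [QTy.instT, QTy.subst_subst, Qual.subst_var]
  exact congrArg (T.subst · _)
    (funext (Fin.cases rfl fun _ => (STy.subst_cases_wkT _ _).symm))

theorem QTy.subst_instQ (τt : Fin a → STy b l) (τq : Fin k → Qual l) (T : QTy a (k + 1))
    (Q : Qual k) :
    (T.instQ Q).subst τt τq =
      (T.subst (fun i => (τt i).wkQ) (upQ τq)).instQ (Q.subst τq) := by
  simp only [QTy.instQ, QTy.subst_subst, STy.subst_cases_wkQ]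
  exact congrArg (T.subst _ ·)
    (funext (Fin.cases rfl fun _ => (Qual.subst_cases_wkQ _ _).symm))

theorem Tm.rename_id {m : ℕ} (t : Tm m a k) : t.rename id id id = t := by
  induction t <;> simp_all [Tm.rename, Qual.rename_id, STy.rename_id, up_id]

end Composition

/-! ### Subqualification -/

section SubQual

variable {m n k m' n' k' : ℕ} {Γ : Ctx m n k} {Γ' : Ctx m' n' k'}

theorem SubQual.refl (Q : Qual k) : SubQual Γ Q Q := by
  induction Q with
  | top => exact .top
  | bot => exact .bot
  | var Y => exact .refl_var
  | meet Q R hQ hR => exact .meet_intro (.meet_elim_1 hQ) (.meet_elim_2 hR)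
  | join Q R hQ hR => exact .join_elim (.join_intro_1 hQ) (.join_intro_2 hR)

theorem SubQual.of_top_left {R : Qual k} (h : SubQual Γ .top R) (Q : Qual k) :
    SubQual Γ Q R := by
  generalize hM : Qual.top = M at h
  induction h with
  | top => exact .top
  | meet_intro _ _ h₁ h₂ => exact .meet_intro (h₁ hM) (h₂ hM)
  | join_intro_1 _ h => exact .join_intro_1 (h hM)
  | join_intro_2 _ h => exact .join_intro_2 (h hM)
  | _ => cases hM

theorem SubQual.of_join_left {A B R : Qual k} (h : SubQual Γ (.join A B) R) :
    SubQual Γ A R ∧ SubQual Γ B R := by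
  generalize hM : Qual.join A B = M at h
  induction h with
  | top => exact ⟨.top, .top⟩
  | meet_intro _ _ h₁ h₂ =>
    exact ⟨.meet_intro (h₁ hM).1 (h₂ hM).1, .meet_intro (h₁ hM).2 (h₂ hM).2⟩
  | join_intro_1 _ h => exact ⟨.join_intro_1 (h hM).1, .join_intro_1 (h hM).2⟩
  | join_intro_2 _ h => exact ⟨.join_intro_2 (h hM).1, .join_intro_2 (h hM).2⟩
  | join_elim h₁ h₂ => cases hM; exact ⟨h₁, h₂⟩
  | _ => cases hM

theorem SubQual.of_meet_left {Q A B R : Qual k} (hA : ∀ M, SubQual Γ A M → SubQual Γ Q M)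
    (hB : ∀ M, SubQual Γ B M → SubQual Γ Q M) (h : SubQual Γ (.meet A B) R) :
    SubQual Γ Q R := by
  generalize hM : Qual.meet A B = M at h
  induction h with
  | top => exact .top
  | meet_elim_1 h => cases hM; exact hA _ h
  | meet_elim_2 h => cases hM; exact hB _ h
  | meet_intro _ _ h₁ h₂ => exact .meet_intro (h₁ hM) (h₂ hM)
  | join_intro_1 _ h => exact .join_intro_1 (h hM)
  | join_intro_2 _ h => exact .join_intro_2 (h hM)
  | _ => cases hM

theorem SubQual.trans {Q M R : Qual k} (h₁ : SubQual Γ Q M) (h₂ : SubQual Γ M R) :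
    SubQual Γ Q R := by
  induction h₁ generalizing R with
  | top => exact h₂.of_top_left _
  | bot => exact .bot
  | refl_var => exact h₂
  | var _ ih => exact .var (ih h₂)
  | meet_elim_1 _ ih => exact .meet_elim_1 (ih h₂)
  | meet_elim_2 _ ih => exact .meet_elim_2 (ih h₂)
  | meet_intro _ _ ih₁ ih₂ => exact .of_meet_left (fun _ => ih₁) (fun _ => ih₂) h₂
  | join_intro_1 _ ih => exact ih h₂.of_join_left.1
  | join_intro_2 _ ih => exact ih h₂.of_join_left.2
  | join_elim _ _ ih₁ ih₂ => exact .join_elim (ih₁ h₂) (ih₂ h₂)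

theorem SubQual.subst {τ : Fin k → Qual k'}
    (hτ : ∀ Y, SubQual Γ' (τ Y) ((Γ.boundQ Y).subst τ)) {Q R : Qual k} (h : SubQual Γ Q R) :
    SubQual Γ' (Q.subst τ) (R.subst τ) := by
  induction h with
  | top => exact .top
  | bot => exact .bot
  | refl_var => exact .refl _
  | var _ ih => exact (hτ _).trans ih
  | meet_elim_1 _ ih => exact .meet_elim_1 ih
  | meet_elim_2 _ ih => exact .meet_elim_2 ih
  | meet_intro _ _ ih₁ ih₂ => exact .meet_intro ih₁ ih₂
  | join_intro_1 _ ih => exact .join_intro_1 ih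
  | join_intro_2 _ ih => exact .join_intro_2 ih
  | join_elim _ _ ih₁ ih₂ => exact .join_elim ih₁ ih₂

theorem SubQual.rename {ρ : Fin k → Fin k'}
    (hρ : ∀ Y, Γ'.boundQ (ρ Y) = (Γ.boundQ Y).rename ρ) {Q R : Qual k} (h : SubQual Γ Q R) :
    SubQual Γ' (Q.rename ρ) (R.rename ρ) := by
  simp only [Qual.rename_eq_subst] at hρ ⊢
  exact h.subst fun Y => .var (hρ Y ▸ .refl _)

theorem SubQual.narrow {Γ' : Ctx m' n' k}
    (hΓ : ∀ Y, SubQual Γ' (Γ'.boundQ Y) (Γ.boundQ Y)) {Q R : Qual k} (h : SubQual Γ Q R) :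
    SubQual Γ' Q R := by
  simpa only [Qual.subst_var] using
    h.subst (τ := Qual.var) fun Y => .var ((Qual.subst_var _).symm ▸ hΓ Y)

theorem SubQual.wkV {Q R : Qual k} (h : SubQual Γ Q R) (T : QTy n k) :
    SubQual (Γ.consV T) Q R :=
  h.narrow (Γ := Γ) (Γ' := Γ.consV T) fun _ => .refl _

theorem SubQual.wkT {Q R : Qual k} (h : SubQual Γ Q R) (B : STy n k) :
    SubQual (Γ.consT B) Q R :=
  h.narrow (Γ := Γ) (Γ' := Γ.consT B) fun _ => .refl _

theorem SubQual.wkQ {Q R : Qual k} (h : SubQual Γ Q R) (B : Qual k) :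
    SubQual (Γ.consQ B) Q.wkQ R.wkQ :=
  h.rename fun _ => rfl

end SubQual

/-! ### Subtyping -/

section BoundRename

variable {m n k m' n' k' : ℕ} {Γ : Ctx m n k} {Γ' : Ctx m' n' k'}
  {ρt : Fin n → Fin n'} {ρq : Fin k → Fin k'}

/-- Renamings of type and qualifier variables that preserve bounds: the bound of a renamed variable
is the renamed bound.  The term variables of the two contexts are unrelated. -/
structure BoundRename (Γ : Ctx m n k) (Γ' : Ctx m' n' k') (ρt : Fin n → Fin n')
    (ρq : Fin k → Fin k') : Prop where
  ty : ∀ X, Γ'.boundT (ρt X) = (Γ.boundT X).rename ρt ρq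
  qual : ∀ Y, Γ'.boundQ (ρq Y) = (Γ.boundQ Y).rename ρq

theorem BoundRename.refl (Γ : Ctx m n k) : BoundRename Γ Γ id id :=
  ⟨fun _ => (STy.rename_id _).symm, fun _ => (Qual.rename_id _).symm⟩

theorem BoundRename.consV (h : BoundRename Γ Γ' ρt ρq) (T : QTy n k) (T' : QTy n' k') :
    BoundRename (Γ.consV T) (Γ'.consV T') ρt ρq :=
  ⟨h.ty, h.qual⟩

theorem BoundRename.consT (h : BoundRename Γ Γ' ρt ρq) (B : STy n k) :
    BoundRename (Γ.consT B) (Γ'.consT (B.rename ρt ρq)) (up ρt) ρq where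
  ty := Fin.cases (STy.rename_wkT _ _ _).symm fun X =>
    (congrArg STy.wkT (h.ty X)).trans (STy.rename_wkT _ _ _).symm
  qual := h.qual

theorem BoundRename.consQ (h : BoundRename Γ Γ' ρt ρq) (B : Qual k) :
    BoundRename (Γ.consQ B) (Γ'.consQ (B.rename ρq)) ρt (up ρq) where
  ty X := (congrArg STy.wkQ (h.ty X)).trans (STy.rename_wkQ _ _ _).symm
  qual := Fin.cases (Qual.rename_wkQ _ _).symm fun Y =>
    (congrArg Qual.wkQ (h.qual Y)).trans (Qual.rename_wkQ _ _).symm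

theorem BoundRename.wkV (Γ : Ctx m n k) (T : QTy n k) : BoundRename Γ (Γ.consV T) id id :=
  ⟨(BoundRename.refl Γ).ty, (BoundRename.refl Γ).qual⟩

theorem BoundRename.wkT (Γ : Ctx m n k) (B : STy n k) :
    BoundRename Γ (Γ.consT B) Fin.succ id :=
  ⟨fun _ => rfl, (BoundRename.refl Γ).qual⟩

theorem BoundRename.wkQ (Γ : Ctx m n k) (B : Qual k) :
    BoundRename Γ (Γ.consQ B) id Fin.succ :=
  ⟨fun _ => rfl, fun _ => rfl⟩

theorem SubS.rename (hρ : BoundRename Γ Γ' ρt ρq) {S U : STy n k} (h : SubS Γ S U) :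
    SubS Γ' (S.rename ρt ρq) (U.rename ρt ρq) := by
  induction h generalizing m' n' k' with
  | top => exact .top
  | refl_var => exact .refl_var
  | var _ ih => exact .var (hρ.ty _ ▸ ih hρ)
  | arr h₁ _ h₂ _ ih₁ ih₂ =>
    exact .arr (h₁.rename hρ.qual) (ih₁ hρ) (h₂.rename hρ.qual) (ih₂ hρ)
  | all _ h₂ _ ih₁ ih₂ =>
    exact .all (ih₁ hρ) (h₂.rename (hρ.consT _).qual) (ih₂ (hρ.consT _))
  | qall h₁ h₂ _ ih =>
    exact .qall (h₁.rename hρ.qual) (h₂.rename (hρ.consQ _).qual) (ih (hρ.consQ _))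
  | box h₁ h₂ _ _ ih₁ ih₂ =>
    exact .box (h₁.rename hρ.qual) (h₂.rename hρ.qual) (ih₁ hρ) (ih₂ hρ)

theorem SubT.rename (hρ : BoundRename Γ Γ' ρt ρq) {T U : QTy n k} (h : SubT Γ T U) :
    SubT Γ' (T.rename ρt ρq) (U.rename ρt ρq) :=
  ⟨h.1.rename hρ.qual, h.2.rename hρ⟩

theorem SubS.wkV {S U : STy n k} (h : SubS Γ S U) (T : QTy n k) : SubS (Γ.consV T) S U := by
  simpa only [STy.rename_id] using h.rename (.wkV Γ T)

theorem SubS.wkT {S U : STy n k} (h : SubS Γ S U) (B : STy n k) :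
    SubS (Γ.consT B) S.wkT U.wkT :=
  h.rename (.wkT Γ B)

theorem SubS.wkQ {S U : STy n k} (h : SubS Γ S U) (B : Qual k) :
    SubS (Γ.consQ B) S.wkQ U.wkQ :=
  h.rename (.wkQ Γ B)

end BoundRename

section Transitivity

variable {m n k m' : ℕ} {Γ : Ctx m n k} {Γ' : Ctx m' n k} {N : ℕ}

theorem SubS.refl (Γ : Ctx m n k) (S : STy n k) : SubS Γ S S := by
  induction S generalizing m with
  | top => exact .top
  | var X => exact .refl_var
  | arr Q₁ S₁ Q₂ S₂ h₁ h₂ => exact .arr (.refl _) (h₁ _) (.refl _) (h₂ _)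
  | all B Q S hB hS => exact .all (hB _) (.refl _) (hS _)
  | qall B Q S hS => exact .qall (.refl _) (.refl _) (hS _)
  | box Q S hS => exact .box (.refl _) (.refl _) (hS _) (hS _)

/-- The number of constructors of a simple type, not counting qualifiers: the measure for the
joint induction of transitivity and narrowing. -/
def STy.size {n k : ℕ} : STy n k → ℕ
  | .top => 1
  | .var _ => 1
  | .arr _ S₁ _ S₂ => S₁.size + S₂.size + 1
  | .all B _ S => B.size + S.size + 1
  | .qall _ _ S => S.size + 1
  | .box _ S => S.size + 1

theorem STy.size_rename {n' k' : ℕ} (ρt : Fin n → Fin n') (ρq : Fin k → Fin k') (S : STy n k) :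
    (S.rename ρt ρq).size = S.size := by
  induction S generalizing n' k' <;> simp_all [STy.rename, STy.size]

/-- Subtyping is transitive through every middle type of size less than `N`, in all contexts. -/
def TransBelow (N : ℕ) : Prop :=
  ∀ {m n k : ℕ} {Γ : Ctx m n k} {S M U : STy n k}, M.size < N →
    SubS Γ S M → SubS Γ M U → SubS Γ S U

/-- `Γ'` narrows the bounds of `Γ`, where only type bounds of size less than `N` in `Γ` may
change. -/
structure BoundNarrow (N : ℕ) (Γ : Ctx m n k) (Γ' : Ctx m' n k) : Prop where
  ty : ∀ X, Γ'.boundT X = Γ.boundT X ∨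
    (Γ.boundT X).size < N ∧ SubS Γ' (Γ'.boundT X) (Γ.boundT X)
  qual : ∀ Y, SubQual Γ' (Γ'.boundQ Y) (Γ.boundQ Y)

theorem BoundNarrow.consT (h : BoundNarrow N Γ Γ') (B : STy n k) :
    BoundNarrow N (Γ.consT B) (Γ'.consT B) where
  ty := Fin.cases (.inl rfl) fun X => (h.ty X).imp (congrArg STy.wkT)
    fun ⟨hN, hX⟩ => ⟨(STy.size_rename _ _ _).trans_lt hN, hX.wkT B⟩
  qual Y := (h.qual Y).wkT B

theorem BoundNarrow.consQ (h : BoundNarrow N Γ Γ') (B : Qual k) :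
    BoundNarrow N (Γ.consQ B) (Γ'.consQ B) where
  ty X := (h.ty X).imp (congrArg STy.wkQ)
    fun ⟨hN, hX⟩ => ⟨(STy.size_rename _ _ _).trans_lt hN, hX.wkQ B⟩
  qual := Fin.cases (.refl _) fun Y => (h.qual Y).wkQ B

theorem BoundNarrow.consT_of_subS {B B' : STy n k} (hN : B.size < N) (h : SubS Γ B' B) :
    BoundNarrow N (Γ.consT B) (Γ.consT B') where
  ty := Fin.cases (.inr ⟨(STy.size_rename _ _ _).trans_lt hN, h.wkT B'⟩) fun _ => .inl rfl
  qual _ := .refl _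

theorem BoundNarrow.consQ_of_subQual {B B' : Qual k} (h : SubQual Γ B' B) :
    BoundNarrow N (Γ.consQ B) (Γ.consQ B') where
  ty _ := .inl rfl
  qual := Fin.cases (h.wkQ B') fun _ => .refl _

theorem SubS.narrow_of_transBelow (hN : TransBelow N) (hΓ : BoundNarrow N Γ Γ') {S U : STy n k}
    (h : SubS Γ S U) : SubS Γ' S U := by
  induction h generalizing m' with
  | top => exact .top
  | refl_var => exact .refl_var
  | @var _ _ _ X _ _ ih =>
    rcases hΓ.ty X with heq | ⟨hsize, hX⟩
    · exact .var (heq ▸ ih hΓ)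
    · exact .var (hN hsize hX (ih hΓ))
  | arr h₁ _ h₂ _ ih₁ ih₂ =>
    exact .arr (h₁.narrow hΓ.qual) (ih₁ hΓ) (h₂.narrow hΓ.qual) (ih₂ hΓ)
  | all _ h₂ _ ih₁ ih₂ =>
    exact .all (ih₁ hΓ) (h₂.narrow (hΓ.consT _).qual) (ih₂ (hΓ.consT _))
  | qall h₁ h₂ _ ih =>
    exact .qall (h₁.narrow hΓ.qual) (h₂.narrow (hΓ.consQ _).qual) (ih (hΓ.consQ _))
  | box h₁ h₂ _ _ ih₁ ih₂ =>
    exact .box (h₁.narrow hΓ.qual) (h₂.narrow hΓ.qual) (ih₁ hΓ) (ih₂ hΓ)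

theorem TransBelow.succ (hN : TransBelow N) : TransBelow (N + 1) := by
  intro m n k Γ S M U hM h₁ h₂
  induction h₁ with
  | top => cases h₂; exact .top
  | refl_var => exact h₂
  | var _ ih => exact .var (ih hM h₂)
  | arr hQ₁ hS₁ hQ₂ hS₂ =>
    simp only [STy.size] at hM
    cases h₂ with
    | top => exact .top
    | arr kQ₁ kS₁ kQ₂ kS₂ =>
      exact .arr (kQ₁.trans hQ₁) (hN (by omega) kS₁ hS₁) (hQ₂.trans kQ₂) (hN (by omega) hS₂ kS₂)
  | all hB hQ hS =>
    simp only [STy.size] at hM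
    cases h₂ with
    | top => exact .top
    | all kB kQ kS =>
      have hΓ := BoundNarrow.consT_of_subS (N := N) (by omega) kB
      exact .all (hN (by omega) kB hB) ((hQ.narrow hΓ.qual).trans kQ)
        (hN (by omega) (hS.narrow_of_transBelow hN hΓ) kS)
  | qall hB hQ hS =>
    simp only [STy.size] at hM
    cases h₂ with
    | top => exact .top
    | qall kB kQ kS =>
      have hΓ := BoundNarrow.consQ_of_subQual (N := N) kB
      exact .qall (kB.trans hB) ((hQ.narrow hΓ.qual).trans kQ)
        (hN (by omega) (hS.narrow_of_transBelow hN hΓ) kS)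
  | box hQ hQ' hS hS' =>
    simp only [STy.size] at hM
    cases h₂ with
    | top => exact .top
    | box kQ kQ' kS kS' =>
      exact .box (hQ.trans kQ) (kQ'.trans hQ') (hN (by omega) hS kS) (hN (by omega) kS' hS')

theorem transBelow (N : ℕ) : TransBelow N := by
  induction N with
  | zero => exact fun h => absurd h (Nat.not_lt_zero _)
  | succ N ih => exact ih.succ

theorem SubS.trans {S M U : STy n k} (h₁ : SubS Γ S M) (h₂ : SubS Γ M U) : SubS Γ S U :=
  transBelow _ (Nat.lt_succ_self _) h₁ h₂

theorem SubT.refl (Γ : Ctx m n k) (T : QTy n k) : SubT Γ T T :=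
  ⟨.refl _, .refl _ _⟩

theorem SubT.trans {T M U : QTy n k} (h₁ : SubT Γ T M) (h₂ : SubT Γ M U) : SubT Γ T U :=
  ⟨h₁.1.trans h₂.1, h₁.2.trans h₂.2⟩

end Transitivity

section BoundSubst

variable {m n k m' n' k' : ℕ} {Γ : Ctx m n k} {Γ' : Ctx m' n' k'}
  {τt : Fin n → STy n' k'} {τq : Fin k → Qual k'}

/-- Substitutions of types and qualifiers over `Γ'` for the variables of `Γ` that respect bounds:
what is substituted for a variable lies below its substituted bound.  The term variables of the two
contexts are unrelated. -/
structure BoundSubst (Γ : Ctx m n k) (Γ' : Ctx m' n' k') (τt : Fin n → STy n' k')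
    (τq : Fin k → Qual k') : Prop where
  ty : ∀ X, SubS Γ' (τt X) ((Γ.boundT X).subst τt τq)
  qual : ∀ Y, SubQual Γ' (τq Y) ((Γ.boundQ Y).subst τq)

theorem BoundSubst.consV (h : BoundSubst Γ Γ' τt τq) (T : QTy n k) (T' : QTy n' k') :
    BoundSubst (Γ.consV T) (Γ'.consV T') τt τq :=
  ⟨fun X => (h.ty X).wkV T', fun Y => (h.qual Y).wkV T'⟩

theorem BoundSubst.consT (h : BoundSubst Γ Γ' τt τq) (B : STy n k) :
    BoundSubst (Γ.consT B) (Γ'.consT (B.subst τt τq)) (upT τt) τq where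
  ty := Fin.cases (.var (STy.subst_wkT τt τq B ▸ .refl _ _)) fun X =>
    STy.subst_wkT τt τq (Γ.boundT X) ▸ (h.ty X).wkT _
  qual Y := (h.qual Y).wkT _

theorem BoundSubst.consQ (h : BoundSubst Γ Γ' τt τq) (B : Qual k) :
    BoundSubst (Γ.consQ B) (Γ'.consQ (B.subst τq)) (fun i => (τt i).wkQ) (upQ τq) where
  ty X := STy.subst_wkQ τt τq (Γ.boundT X) ▸ (h.ty X).wkQ _
  qual := Fin.cases (.var (Qual.subst_wkQ τq B ▸ .refl _)) fun Y =>
    Qual.subst_wkQ τq (Γ.boundQ Y) ▸ (h.qual Y).wkQ _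

theorem SubS.subst (hτ : BoundSubst Γ Γ' τt τq) {S U : STy n k} (h : SubS Γ S U) :
    SubS Γ' (S.subst τt τq) (U.subst τt τq) := by
  induction h generalizing m' n' k' with
  | top => exact .top
  | refl_var => exact .refl _ _
  | var _ ih => exact (hτ.ty _).trans (ih hτ)
  | arr h₁ _ h₂ _ ih₁ ih₂ =>
    exact .arr (h₁.subst hτ.qual) (ih₁ hτ) (h₂.subst hτ.qual) (ih₂ hτ)
  | all _ h₂ _ ih₁ ih₂ =>
    exact .all (ih₁ hτ) (h₂.subst (hτ.consT _).qual) (ih₂ (hτ.consT _))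
  | qall h₁ h₂ _ ih =>
    exact .qall (h₁.subst hτ.qual) (h₂.subst (hτ.consQ _).qual) (ih (hτ.consQ _))
  | box h₁ h₂ _ _ ih₁ ih₂ =>
    exact .box (h₁.subst hτ.qual) (h₂.subst hτ.qual) (ih₁ hτ) (ih₂ hτ)

theorem SubT.subst (hτ : BoundSubst Γ Γ' τt τq) {T U : QTy n k} (h : SubT Γ T U) :
    SubT Γ' (T.subst τt τq) (U.subst τt τq) :=
  ⟨h.1.subst hτ.qual, h.2.subst hτ⟩

theorem BoundSubst.refl (Γ : Ctx m n k) : BoundSubst Γ Γ STy.var Qual.var where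
  ty _ := .var ((STy.subst_var _).symm ▸ .refl _ _)
  qual _ := .var ((Qual.subst_var _).symm ▸ .refl _)

theorem BoundSubst.instV (Γ : Ctx m n k) (T : QTy n k) :
    BoundSubst (Γ.consV T) Γ STy.var Qual.var :=
  ⟨(BoundSubst.refl Γ).ty, (BoundSubst.refl Γ).qual⟩

theorem BoundSubst.instT {B S : STy n k} (h : SubS Γ S B) :
    BoundSubst (Γ.consT B) Γ (Fin.cases S STy.var) Qual.var where
  ty := Fin.cases ((STy.subst_cases_wkT B S).symm ▸ h) fun X =>
    .var ((STy.subst_cases_wkT (Γ.boundT X) S).symm ▸ .refl _ _)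
  qual := (BoundSubst.refl Γ).qual

theorem BoundSubst.instQ {B R : Qual k} (h : SubQual Γ R B) :
    BoundSubst (Γ.consQ B) Γ STy.var (Fin.cases R Qual.var) where
  ty X := .var ((STy.subst_cases_wkQ (Γ.boundT X) R).symm ▸ .refl _ _)
  qual := Fin.cases ((Qual.subst_cases_wkQ B R).symm ▸ h) fun Y =>
    .var ((Qual.subst_cases_wkQ (Γ.boundQ Y) R).symm ▸ .refl _)

end BoundSubst

/-! ### Renaming and substitution in typing derivations -/

section CtxRename

variable {m n k m' n' k' : ℕ} {Γ : Ctx m n k} {Γ' : Ctx m' n' k'} {E : StoreEnv n k}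
  {E' : StoreEnv n' k'} {ρ : Fin m → Fin m'} {ρt : Fin n → Fin n'} {ρq : Fin k → Fin k'}

theorem StoreEnv.wkT_eq_some {l : ℕ} {T : QTy (n + 1) k} :
    E.wkT l = some T ↔ ∃ U, E l = some U ∧ U.wkT = T :=
  Option.map_eq_some_iff

theorem StoreEnv.wkQ_eq_some {l : ℕ} {T : QTy n (k + 1)} :
    E.wkQ l = some T ↔ ∃ U, E l = some U ∧ U.wkQ = T :=
  Option.map_eq_some_iff

/-- Renamings of all three sorts of variables that preserve types and bounds, together with a store
environment `E'` that contains the renamed types of `E` and possibly further locations. -/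
structure CtxRename (Γ : Ctx m n k) (E : StoreEnv n k) (Γ' : Ctx m' n' k')
    (E' : StoreEnv n' k') (ρ : Fin m → Fin m') (ρt : Fin n → Fin n') (ρq : Fin k → Fin k') :
    Prop extends BoundRename Γ Γ' ρt ρq where
  var : ∀ x, Γ'.typeOf (ρ x) = (Γ.typeOf x).rename ρt ρq
  store : ∀ l T, E l = some T → E' l = some (T.rename ρt ρq)

theorem CtxRename.consV (h : CtxRename Γ E Γ' E' ρ ρt ρq) (T : QTy n k) :
    CtxRename (Γ.consV T) E (Γ'.consV (T.rename ρt ρq)) E' (up ρ) ρt ρq where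
  toBoundRename := h.toBoundRename.consV _ _
  var := Fin.cases rfl h.var
  store := h.store

theorem CtxRename.consT (h : CtxRename Γ E Γ' E' ρ ρt ρq) (B : STy n k) :
    CtxRename (Γ.consT B) E.wkT (Γ'.consT (B.rename ρt ρq)) E'.wkT ρ (up ρt) ρq where
  toBoundRename := h.toBoundRename.consT _
  var x := (congrArg QTy.wkT (h.var x)).trans (QTy.rename_wkT _ _ _).symm
  store l T hT := by
    obtain ⟨U, hU, rfl⟩ := StoreEnv.wkT_eq_some.1 hT
    exact StoreEnv.wkT_eq_some.2 ⟨_, h.store l U hU, (QTy.rename_wkT _ _ _).symm⟩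

theorem CtxRename.consQ (h : CtxRename Γ E Γ' E' ρ ρt ρq) (B : Qual k) :
    CtxRename (Γ.consQ B) E.wkQ (Γ'.consQ (B.rename ρq)) E'.wkQ ρ ρt (up ρq) where
  toBoundRename := h.toBoundRename.consQ _
  var x := (congrArg QTy.wkQ (h.var x)).trans (QTy.rename_wkQ _ _ _).symm
  store l T hT := by
    obtain ⟨U, hU, rfl⟩ := StoreEnv.wkQ_eq_some.1 hT
    exact StoreEnv.wkQ_eq_some.2 ⟨_, h.store l U hU, (QTy.rename_wkQ _ _ _).symm⟩

theorem HasType.rename (hρ : CtxRename Γ E Γ' E' ρ ρt ρq) {t : Tm m n k} {T : QTy n k}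
    (h : HasType Γ E t T) : HasType Γ' E' (t.rename ρ ρt ρq) (T.rename ρt ρq) := by
  induction h generalizing m' n' k' with
  | var => exact hρ.var _ ▸ .var
  | abs _ ih => exact .abs (ih (hρ.consV _))
  | t_abs _ ih => exact .t_abs (T := QTy.rename _ _ _) (ih (hρ.consT _))
  | q_abs _ ih => exact .q_abs (T := QTy.rename _ _ _) (ih (hρ.consQ _))
  | app _ _ ih₁ ih₂ => exact .app (T := QTy.rename _ _ _) (U := QTy.rename _ _ _) (ih₁ hρ) (ih₂ hρ)
  | t_app _ h ih =>
    rw [QTy.rename_instT]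
    exact .t_app (T := QTy.rename _ _ _) (ih hρ) (h.rename hρ.toBoundRename)
  | q_app _ h ih =>
    rw [QTy.rename_instQ]
    exact .q_app (T := QTy.rename _ _ _) (ih hρ) (h.rename hρ.qual)
  | sub _ h ih => exact .sub (ih hρ) (h.rename hρ.toBoundRename)
  | typ_assert _ h ih => exact .typ_assert (ih hρ) (h.rename hρ.qual)
  | typ_upqual _ h ih => exact .typ_upqual (ih hρ) (h.rename hρ.qual)
  | ref_intro _ ih => exact .ref_intro (T := QTy.rename _ _ _) (ih hρ)
  | loc h => exact .loc (T := QTy.rename _ _ _) (hρ.store _ _ h)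
  | ref_elim _ ih => exact .ref_elim (ih hρ)
  | ref_update _ _ ih₁ ih₂ => exact .ref_update (T := QTy.rename _ _ _) (ih₁ hρ) (ih₂ hρ)

end CtxRename

section Weakening

variable {m n k : ℕ} {Γ : Ctx m n k} {E E' : StoreEnv n k} {t : Tm m n k} {T : QTy n k}

theorem HasType.wkV (h : HasType Γ E t T) (U : QTy n k) : HasType (Γ.consV U) E t.wkV T := by
  have hρ : CtxRename Γ E (Γ.consV U) E Fin.succ id id :=
    ⟨.wkV Γ U, fun _ => (QTy.rename_id _).symm, fun _ T h => by rwa [QTy.rename_id]⟩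
  exact QTy.rename_id T ▸ h.rename hρ

theorem HasType.wkT (h : HasType Γ E t T) (B : STy n k) :
    HasType (Γ.consT B) E.wkT t.wkT T.wkT :=
  h.rename ⟨.wkT Γ B, fun _ => rfl, fun _ T h => StoreEnv.wkT_eq_some.2 ⟨T, h, rfl⟩⟩

theorem HasType.wkQ (h : HasType Γ E t T) (B : Qual k) :
    HasType (Γ.consQ B) E.wkQ t.wkQ T.wkQ :=
  h.rename ⟨.wkQ Γ B, fun _ => rfl, fun _ T h => StoreEnv.wkQ_eq_some.2 ⟨T, h, rfl⟩⟩

theorem HasType.extend (h : HasType Γ E t T) (hE : E'.Extends E) : HasType Γ E' t T := by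
  have hρ : CtxRename Γ E Γ E' id id id :=
    ⟨.refl Γ, fun _ => (QTy.rename_id _).symm, fun l T h => by rw [QTy.rename_id, hE l T h]⟩
  simpa only [Tm.rename_id, QTy.rename_id] using h.rename hρ

end Weakening

section CtxSubst

variable {m n k m' n' k' : ℕ} {Γ : Ctx m n k} {Γ' : Ctx m' n' k'} {E : StoreEnv n k}
  {E' : StoreEnv n' k'} {τ : Fin m → Tm m' n' k'} {τt : Fin n → STy n' k'}
  {τq : Fin k → Qual k'}

/-- Substitutions for all three sorts of variables that respect types and bounds, together with a
store environment `E'` that contains the substituted types of `E` and possibly further locations. -/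
structure CtxSubst (Γ : Ctx m n k) (E : StoreEnv n k) (Γ' : Ctx m' n' k')
    (E' : StoreEnv n' k') (τ : Fin m → Tm m' n' k') (τt : Fin n → STy n' k')
    (τq : Fin k → Qual k') : Prop extends BoundSubst Γ Γ' τt τq where
  var : ∀ x, HasType Γ' E' (τ x) ((Γ.typeOf x).subst τt τq)
  store : ∀ l T, E l = some T → E' l = some (T.subst τt τq)

theorem CtxSubst.consV (h : CtxSubst Γ E Γ' E' τ τt τq) (T : QTy n k) :
    CtxSubst (Γ.consV T) E (Γ'.consV (T.subst τt τq)) E' (upV τ) τt τq where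
  toBoundSubst := h.toBoundSubst.consV _ _
  var := Fin.cases .var fun x => (h.var x).wkV _
  store := h.store

theorem CtxSubst.consT (h : CtxSubst Γ E Γ' E' τ τt τq) (B : STy n k) :
    CtxSubst (Γ.consT B) E.wkT (Γ'.consT (B.subst τt τq)) E'.wkT (fun i => (τ i).wkT)
      (upT τt) τq where
  toBoundSubst := h.toBoundSubst.consT _
  var x := QTy.subst_wkT τt τq (Γ.typeOf x) ▸ (h.var x).wkT _
  store l T hT := by
    obtain ⟨U, hU, rfl⟩ := StoreEnv.wkT_eq_some.1 hT
    exact StoreEnv.wkT_eq_some.2 ⟨_, h.store l U hU, (QTy.subst_wkT _ _ _).symm⟩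

theorem CtxSubst.consQ (h : CtxSubst Γ E Γ' E' τ τt τq) (B : Qual k) :
    CtxSubst (Γ.consQ B) E.wkQ (Γ'.consQ (B.subst τq)) E'.wkQ (fun i => (τ i).wkQ)
      (fun i => (τt i).wkQ) (upQ τq) where
  toBoundSubst := h.toBoundSubst.consQ _
  var x := QTy.subst_wkQ τt τq (Γ.typeOf x) ▸ (h.var x).wkQ _
  store l T hT := by
    obtain ⟨U, hU, rfl⟩ := StoreEnv.wkQ_eq_some.1 hT
    exact StoreEnv.wkQ_eq_some.2 ⟨_, h.store l U hU, (QTy.subst_wkQ _ _ _).symm⟩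

theorem HasType.subst (hτ : CtxSubst Γ E Γ' E' τ τt τq) {t : Tm m n k} {T : QTy n k}
    (h : HasType Γ E t T) : HasType Γ' E' (t.subst τ τt τq) (T.subst τt τq) := by
  induction h generalizing m' n' k' with
  | var => exact hτ.var _
  | abs _ ih => exact .abs (ih (hτ.consV _))
  | t_abs _ ih => exact .t_abs (T := QTy.subst _ _ _) (ih (hτ.consT _))
  | q_abs _ ih => exact .q_abs (T := QTy.subst _ _ _) (ih (hτ.consQ _))
  | app _ _ ih₁ ih₂ => exact .app (T := QTy.subst _ _ _) (U := QTy.subst _ _ _) (ih₁ hτ) (ih₂ hτ)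
  | t_app _ h ih =>
    rw [QTy.subst_instT]
    exact .t_app (T := QTy.subst _ _ _) (ih hτ) (h.subst hτ.toBoundSubst)
  | q_app _ h ih =>
    rw [QTy.subst_instQ]
    exact .q_app (T := QTy.subst _ _ _) (ih hτ) (h.subst hτ.qual)
  | sub _ h ih => exact .sub (ih hτ) (h.subst hτ.toBoundSubst)
  | typ_assert _ h ih => exact .typ_assert (ih hτ) (h.subst hτ.qual)
  | typ_upqual _ h ih => exact .typ_upqual (ih hτ) (h.subst hτ.qual)
  | ref_intro _ ih => exact .ref_intro (T := QTy.subst _ _ _) (ih hτ)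
  | loc h => exact .loc (T := QTy.subst _ _ _) (hτ.store _ _ h)
  | ref_elim _ ih => exact .ref_elim (ih hτ)
  | ref_update _ _ ih₁ ih₂ => exact .ref_update (T := QTy.subst _ _ _) (ih₁ hτ) (ih₂ hτ)

end CtxSubst

section Instantiation

variable {m n k : ℕ} {Γ : Ctx m n k} {E : StoreEnv n k}

theorem HasType.instV {t : Tm (m + 1) n k} {v : Tm m n k} {T U : QTy n k}
    (ht : HasType (Γ.consV T) E t U) (hv : HasType Γ E v T) : HasType Γ E (t.instV v) U := by
  have hτ : CtxSubst (Γ.consV T) E Γ E (Fin.cases v Tm.var) STy.var Qual.var :=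
    { BoundSubst.instV Γ T with
      var := Fin.cases ((QTy.subst_var T).symm ▸ hv) fun x =>
        (QTy.subst_var (Γ.typeOf x)).symm ▸ .var
      store := fun _ T h => (QTy.subst_var T).symm ▸ h }
  exact QTy.subst_var U ▸ ht.subst hτ

theorem HasType.instT {t : Tm m (n + 1) k} {B S : STy n k} {T : QTy (n + 1) k}
    (ht : HasType (Γ.consT B) E.wkT t T) (hS : SubS Γ S B) :
    HasType Γ E (t.instT S) (T.instT S) := by
  refine ht.subst ⟨.instT hS, fun x => ?_, fun l T hT => ?_⟩
  · change HasType Γ E (.var x) ((Γ.typeOf x).wkT.instT S)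
    exact QTy.wkT_instT _ _ ▸ .var
  · obtain ⟨U, hU, rfl⟩ := StoreEnv.wkT_eq_some.1 hT
    change E l = some (U.wkT.instT S)
    rwa [QTy.wkT_instT]

theorem HasType.instQ {t : Tm m n (k + 1)} {B R : Qual k} {T : QTy n (k + 1)}
    (ht : HasType (Γ.consQ B) E.wkQ t T) (hR : SubQual Γ R B) :
    HasType Γ E (t.instQ R) (T.instQ R) := by
  refine ht.subst ⟨.instQ hR, fun x => ?_, fun l T hT => ?_⟩
  · change HasType Γ E (.var x) ((Γ.typeOf x).wkQ.instQ R)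
    exact QTy.wkQ_instQ _ _ ▸ .var
  · obtain ⟨U, hU, rfl⟩ := StoreEnv.wkQ_eq_some.1 hT
    change E l = some (U.wkQ.instQ R)
    rwa [QTy.wkQ_instQ]

end Instantiation

/-! ### Typing of values -/

section Values

variable {m n k : ℕ} {Γ : Ctx m n k} {E : StoreEnv n k}

theorem HasType.lam_inv {P : Qual k} {t : Tm (m + 1) n k} {V : QTy n k}
    (h : HasType Γ E (.lam P t) V) :
    ∃ T U, HasType (Γ.consV T) E t U ∧ SubT Γ ⟨P, .arrow T U⟩ V := by
  generalize hs : Tm.lam P t = s at h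
  induction h with
  | abs h => cases hs; exact ⟨_, _, h, .refl _ _⟩
  | sub _ h ih =>
    obtain ⟨T, U, ht, hV⟩ := ih hs
    exact ⟨T, U, ht, hV.trans h⟩
  | _ => cases hs

theorem HasType.tlam_inv {P : Qual k} {B : STy n k} {t : Tm m (n + 1) k} {V : QTy n k}
    (h : HasType Γ E (.tlam P B t) V) :
    ∃ T, HasType (Γ.consT B) E.wkT t T ∧ SubT Γ ⟨P, .allT B T⟩ V := by
  generalize hs : Tm.tlam P B t = s at h
  induction h with
  | t_abs h => cases hs; exact ⟨_, h, .refl _ _⟩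
  | sub _ h ih =>
    obtain ⟨T, ht, hV⟩ := ih hs
    exact ⟨T, ht, hV.trans h⟩
  | _ => cases hs

theorem HasType.qlam_inv {P B : Qual k} {t : Tm m n (k + 1)} {V : QTy n k}
    (h : HasType Γ E (.qlam P B t) V) :
    ∃ T, HasType (Γ.consQ B) E.wkQ t T ∧ SubT Γ ⟨P, .allQ B T⟩ V := by
  generalize hs : Tm.qlam P B t = s at h
  induction h with
  | q_abs h => cases hs; exact ⟨_, h, .refl _ _⟩
  | sub _ h ih =>
    obtain ⟨T, ht, hV⟩ := ih hs
    exact ⟨T, ht, hV.trans h⟩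
  | _ => cases hs

theorem HasType.loc_inv {P : Qual k} {l : ℕ} {V : QTy n k} (h : HasType Γ E (.loc P l) V) :
    ∃ T, E l = some T ∧ SubT Γ ⟨P, .ref T⟩ V := by
  generalize hs : Tm.loc P l = s at h
  induction h with
  | loc h => cases hs; exact ⟨_, h, .refl _ _⟩
  | sub _ h ih =>
    obtain ⟨T, ht, hV⟩ := ih hs
    exact ⟨T, ht, hV.trans h⟩
  | _ => cases hs

theorem HasType.loc_ref_inv {P R : Qual k} {l : ℕ} {T : QTy n k}
    (h : HasType Γ E (.loc P l) ⟨R, .ref T⟩) :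
    ∃ U, E l = some U ∧ SubQual Γ P R ∧ SubT Γ U T ∧ SubT Γ T U := by
  obtain ⟨U, hU, hP, hS⟩ := h.loc_inv
  cases hS with
  | box h₁ h₂ h₃ h₄ => exact ⟨U, hU, hP, ⟨h₁, h₃⟩, h₂, h₄⟩

theorem HasType.subQual_of_hasTag {v : Tm m n k} {Q : Qual k} {T : QTy n k}
    (h : HasType Γ E v T) (hQ : HasTag v Q) : SubQual Γ Q T.qual := by
  cases hQ with
  | lam => obtain ⟨_, _, _, hT⟩ := h.lam_inv; exact hT.1
  | tlam => obtain ⟨_, _, hT⟩ := h.tlam_inv; exact hT.1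
  | qlam => obtain ⟨_, _, hT⟩ := h.qlam_inv; exact hT.1
  | loc => obtain ⟨_, _, hT⟩ := h.loc_inv; exact hT.1

theorem HasType.retag {v : Tm m n k} {T : QTy n k} (h : HasType Γ E v T) (hv : IsValue v)
    (P : Qual k) : HasType Γ E (v.retag P) ⟨P, T.ty⟩ := by
  cases hv with
  | lam => obtain ⟨_, _, ht, hT⟩ := h.lam_inv; exact .sub (.abs ht) ⟨.refl P, hT.2⟩
  | tlam => obtain ⟨_, ht, hT⟩ := h.tlam_inv; exact .sub (.t_abs ht) ⟨.refl P, hT.2⟩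
  | qlam => obtain ⟨_, ht, hT⟩ := h.qlam_inv; exact .sub (.q_abs ht) ⟨.refl P, hT.2⟩
  | loc => obtain ⟨_, hl, hT⟩ := h.loc_inv; exact .sub (.loc hl) ⟨.refl P, hT.2⟩

theorem HasType.instV_of_lam {P Q : Qual k} {t : Tm (m + 1) n k} {v : Tm m n k} {T U : QTy n k}
    (h : HasType Γ E (.lam P t) ⟨Q, .arrow T U⟩) (hv : HasType Γ E v T) :
    HasType Γ E (t.instV v) U := by
  obtain ⟨T₀, U₀, ht, -, hS⟩ := h.lam_inv
  cases hS with
  | arr hTQ hTS hUQ hUS => exact .sub (ht.instV (.sub hv ⟨hTQ, hTS⟩)) ⟨hUQ, hUS⟩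

theorem HasType.instT_of_tlam {P Q : Qual k} {B B' S : STy n k} {t : Tm m (n + 1) k}
    {T : QTy (n + 1) k} (h : HasType Γ E (.tlam P B t) ⟨Q, .allT B' T⟩) (hS : SubS Γ S B') :
    HasType Γ E (t.instT S) (T.instT S) := by
  obtain ⟨T₀, ht, -, hall⟩ := h.tlam_inv
  cases hall with
  | all hB hTQ hTS =>
    exact .sub (ht.instT (hS.trans hB)) (SubT.subst (.instT hS) ⟨hTQ, hTS⟩)

theorem HasType.instQ_of_qlam {P Q B B' R : Qual k} {t : Tm m n (k + 1)} {T : QTy n (k + 1)}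
    (h : HasType Γ E (.qlam P B t) ⟨Q, .allQ B' T⟩) (hR : SubQual Γ R B') :
    HasType Γ E (t.instQ R) (T.instQ R) := by
  obtain ⟨T₀, ht, -, hall⟩ := h.qlam_inv
  cases hall with
  | qall hB hTQ hTS =>
    exact .sub (ht.instQ (hR.trans hB)) (SubT.subst (.instQ hR) ⟨hTQ, hTS⟩)

end Values

/-! ### Stores -/

section Stores

variable {m n k : ℕ} {Γ : Ctx m n k} {E : StoreEnv n k} {σ : Store m n k} {l : ℕ}
  {v w : Val m n k} {P Q R : Qual k} {T : QTy n k}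

/-- The store environment `E` with the type of the location `l` set to `T`. -/
def StoreEnv.insert (E : StoreEnv n k) (l : ℕ) (T : QTy n k) : StoreEnv n k :=
  Function.update E l (some T)

theorem StoreEnv.insert_self (E : StoreEnv n k) (l : ℕ) (T : QTy n k) :
    E.insert l T l = some T :=
  Function.update_self ..

theorem StoreEnv.insert_of_ne (E : StoreEnv n k) {l l' : ℕ} (h : l' ≠ l) (T : QTy n k) :
    E.insert l T l' = E l' :=
  Function.update_of_ne h ..

theorem StoreEnv.Extends.refl (E : StoreEnv n k) : E.Extends E :=
  fun _ _ h => h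

theorem StoreEnv.insert_extends (h : ∀ U, E l = some U → U = T) : (E.insert l T).Extends E := by
  intro l' U hU
  rcases eq_or_ne l' l with rfl | hne
  · rw [insert_self, h U hU]
  · rw [insert_of_ne E hne, hU]

theorem StoreTyped.insert (hσ : StoreTyped Γ E σ) (hv : HasType Γ E v.1 T)
    (hE : (E.insert l T).Extends E) : StoreTyped Γ (E.insert l T) (σ.insert l v) := by
  refine ⟨fun l' => ?_, fun l' w U hw hU => ?_⟩ <;> rcases eq_or_ne l' l with rfl | hne
  · simp [StoreEnv.insert_self]
  · simp [Finmap.mem_insert, hne, StoreEnv.insert_of_ne, hσ.1]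
  · rw [Finmap.lookup_insert, Option.some_inj] at hw
    rw [StoreEnv.insert_self, Option.some_inj] at hU
    exact hw ▸ hU ▸ hv.extend hE
  · rw [Finmap.lookup_insert_of_ne _ hne] at hw
    rw [StoreEnv.insert_of_ne E hne] at hU
    exact (hσ.2 l' w U hw hU).extend hE

theorem StoreTyped.eq_none_of_notMem (hσ : StoreTyped Γ E σ) (hl : l ∉ σ) : E l = none := by
  rwa [← Option.not_isSome_iff_eq_none, hσ.1]

theorem StoreTyped.hasType_of_loc (hσ : StoreTyped Γ E σ)
    (hl : HasType Γ E (.loc P l) ⟨R, .ref T⟩) (hw : σ.lookup l = some w) : HasType Γ E w.1 T := by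
  obtain ⟨U, hU, -, hUT, -⟩ := hl.loc_ref_inv
  exact .sub (hσ.2 l w U hw hU) hUT

theorem StoreTyped.hasType_retag_of_loc (hσ : StoreTyped Γ E σ)
    (hl : HasType Γ E (.loc P l) ⟨R, .ref T⟩) (hw : σ.lookup l = some w) (hQ : HasTag w.1 Q) :
    HasType Γ E (w.1.retag (.join P Q)) ⟨.join R T.qual, T.ty⟩ := by
  obtain ⟨-, -, hPR, -⟩ := hl.loc_ref_inv
  have hwT := hσ.hasType_of_loc hl hw
  have hjoin : SubQual Γ (.join P Q) (.join R T.qual) :=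
    .join_elim (.join_intro_1 hPR) (.join_intro_2 (hwT.subQual_of_hasTag hQ))
  exact .sub (hwT.retag w.2 _) ⟨hjoin, .refl _ _⟩

end Stores

/-! ### Preservation -/

section Preservation

variable {m n k : ℕ} {Γ : Ctx m n k} {E : StoreEnv n k} {σ : Store m n k}
  {s t t' : Tm m n k} {P Q R : Qual k} {T T' U : QTy n k}

/-- The configuration `⟨t, σ⟩` is well typed, with `t` of type `T`, over some extension of `E`. -/
def ConfigTyped (Γ : Ctx m n k) (E : StoreEnv n k) (t : Tm m n k) (σ : Store m n k)
    (T : QTy n k) : Prop :=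
  ∃ E' : StoreEnv n k, E'.Extends E ∧ StoreTyped Γ E' σ ∧ HasType Γ E' t T

theorem StoreTyped.configTyped (hσ : StoreTyped Γ E σ) (ht : HasType Γ E t T) :
    ConfigTyped Γ E t σ T :=
  ⟨E, .refl E, hσ, ht⟩

theorem ConfigTyped.map (h : ConfigTyped Γ E t σ T)
    (f : ∀ E' : StoreEnv n k, E'.Extends E → HasType Γ E' t T → HasType Γ E' t' T') :
    ConfigTyped Γ E t' σ T' :=
  let ⟨E', hE, hσ, ht⟩ := h
  ⟨E', hE, hσ, f E' hE ht⟩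

theorem StoreTyped.configTyped_alloc (hσ : StoreTyped Γ E σ) {l : ℕ} (hl : l ∉ σ)
    {v : Val m n k} (hv : HasType Γ E v.1 T) :
    ConfigTyped Γ E (.loc P l) (σ.insert l v) ⟨P, .ref T⟩ := by
  have hE : (E.insert l T).Extends E :=
    StoreEnv.insert_extends (by simp [hσ.eq_none_of_notMem hl])
  exact ⟨_, hE, hσ.insert hv hE, .loc (E.insert_self l T)⟩

theorem StoreTyped.configTyped_update (hσ : StoreTyped Γ E σ) {l : ℕ} {v w : Val m n k}
    (hl : HasType Γ E (.loc P l) ⟨R, .ref T⟩) (hv : HasType Γ E v.1 T)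
    (hw : σ.lookup l = some w) : ConfigTyped Γ E w.1 (σ.insert l v) T := by
  obtain ⟨U, hU, -, -, hTU⟩ := hl.loc_ref_inv
  have hE : (E.insert l U).Extends E := StoreEnv.insert_extends (by simp [hU])
  exact ⟨_, hE, hσ.insert (.sub hv hTU) hE, (hσ.hasType_of_loc hl hw).extend hE⟩

/-- Every reduct of the configuration `⟨s, σ⟩` is well typed at `T` over an extension of `E`: the
induction predicate of the preservation theorem. -/
def Preserves (Γ : Ctx m n k) (E : StoreEnv n k) (σ : Store m n k) (s : Tm m n k)
    (T : QTy n k) : Prop :=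
  ∀ (t : Tm m n k) (σ' : Store m n k), Step s σ t σ' → ConfigTyped Γ E t σ' T

theorem Preserves.sub (ih : Preserves Γ E σ s T) (h : SubT Γ T U) : Preserves Γ E σ s U :=
  fun t σ' hstep => (ih t σ' hstep).map fun _ _ ht => .sub ht h

theorem Preserves.app (hσ : StoreTyped Γ E σ) (hs : HasType Γ E s ⟨Q, .arrow T U⟩)
    (ht : HasType Γ E t T) (ihs : Preserves Γ E σ s ⟨Q, .arrow T U⟩)
    (iht : Preserves Γ E σ t T) : Preserves Γ E σ (.app s t) U := by
  intro r σ' hstep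
  cases hstep with
  | beta_v _ => exact hσ.configTyped (hs.instV_of_lam ht)
  | app_left h => exact (ihs _ _ h).map fun _ hE hs' => .app hs' (ht.extend hE)
  | app_right _ h => exact (iht _ _ h).map fun _ hE ht' => .app (hs.extend hE) ht'

theorem Preserves.t_app (hσ : StoreTyped Γ E σ) {B S : STy n k} {T : QTy (n + 1) k}
    (hs : HasType Γ E s ⟨Q, .allT B T⟩) (hS : SubS Γ S B)
    (ih : Preserves Γ E σ s ⟨Q, .allT B T⟩) : Preserves Γ E σ (.tapp s S) (T.instT S) := by
  intro r σ' hstep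
  cases hstep with
  | beta_T => exact hσ.configTyped (hs.instT_of_tlam hS)
  | tapp_fun h => exact (ih _ _ h).map fun _ _ hs' => .t_app hs' hS

theorem Preserves.q_app (hσ : StoreTyped Γ E σ) {B : Qual k} {T : QTy n (k + 1)}
    (hs : HasType Γ E s ⟨Q, .allQ B T⟩) (hR : SubQual Γ R B)
    (ih : Preserves Γ E σ s ⟨Q, .allQ B T⟩) : Preserves Γ E σ (.qapp s R) (T.instQ R) := by
  intro r σ' hstep
  cases hstep with
  | beta_Q => exact hσ.configTyped (hs.instQ_of_qlam hR)
  | qapp_fun h => exact (ih _ _ h).map fun _ _ hs' => .q_app hs' hR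

theorem Preserves.typ_assert (hσ : StoreTyped Γ E σ) {S : STy n k} (hs : HasType Γ E s ⟨Q, S⟩)
    (hQP : SubQual Γ Q P) (ih : Preserves Γ E σ s ⟨Q, S⟩) :
    Preserves Γ E σ (.assert P s) ⟨Q, S⟩ := by
  intro r σ' hstep
  cases hstep with
  | assert => exact hσ.configTyped hs
  | assert_arg h => exact (ih _ _ h).map fun _ _ hs' => .typ_assert hs' hQP

theorem Preserves.typ_upqual (hσ : StoreTyped Γ E σ) {S : STy n k} (hs : HasType Γ E s ⟨Q, S⟩)
    (hQP : SubQual Γ Q P) (ih : Preserves Γ E σ s ⟨Q, S⟩) :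
    Preserves Γ E σ (.upqual P s) ⟨P, S⟩ := by
  intro r σ' hstep
  cases hstep with
  | upqual hv => exact hσ.configTyped (hs.retag hv P)
  | upqual_arg h => exact (ih _ _ h).map fun _ _ hs' => .typ_upqual hs' hQP

theorem Preserves.ref_intro (hσ : StoreTyped Γ E σ) (hs : HasType Γ E s T)
    (ih : Preserves Γ E σ s T) : Preserves Γ E σ (.box P s) ⟨P, .ref T⟩ := by
  intro r σ' hstep
  cases hstep with
  | ref hl => exact hσ.configTyped_alloc hl hs
  | box_arg h => exact (ih _ _ h).map fun _ _ hs' => .ref_intro hs'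

theorem Preserves.ref_elim (hσ : StoreTyped Γ E σ) (hs : HasType Γ E s ⟨R, .ref T⟩)
    (ih : Preserves Γ E σ s ⟨R, .ref T⟩) :
    Preserves Γ E σ (.unbox s) ⟨.join R T.qual, T.ty⟩ := by
  intro r σ' hstep
  cases hstep with
  | deref hw hQ => exact hσ.configTyped (hσ.hasType_retag_of_loc hs hw hQ)
  | unbox_arg h => exact (ih _ _ h).map fun _ _ hs' => .ref_elim hs'

theorem Preserves.ref_update (hσ : StoreTyped Γ E σ) (hs : HasType Γ E s ⟨.bot, .ref T⟩)
    (ht : HasType Γ E t T) (ihs : Preserves Γ E σ s ⟨.bot, .ref T⟩)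
    (iht : Preserves Γ E σ t T) : Preserves Γ E σ (.setbox s t) T := by
  intro r σ' hstep
  cases hstep with
  | update _ hw => exact hσ.configTyped_update hs ht hw
  | setbox_left h => exact (ihs _ _ h).map fun _ hE hs' => .ref_update hs' (ht.extend hE)
  | setbox_right _ h => exact (iht _ _ h).map fun _ hE ht' => .ref_update (hs.extend hE) ht'

end Preservation

end FM

theorem mainTheorem5 {m n k : ℕ} (Γ : FM.Ctx m n k) (E : FM.StoreEnv n k)
    (s t : FM.Tm m n k) (σ σ' : FM.Store m n k) (T : FM.QTy n k)
    (hstep : FM.Step s σ t σ')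
    (hσ : FM.StoreTyped Γ E σ)
    (hs : FM.HasType Γ E s T) :
    ∃ E' : FM.StoreEnv n k, E'.Extends E ∧ FM.StoreTyped Γ E' σ' ∧ FM.HasType Γ E' t T := by
  suffices FM.Preserves Γ E σ s T from this t σ' hstep
  clear t σ' hstep
  induction hs with
  | var | abs | t_abs | q_abs | loc => exact fun _ _ hstep => nomatch hstep
  | sub _ hTU ih => exact (ih _ hσ).sub hTU
  | app hs ht ihs iht => exact .app hσ hs ht (ihs _ hσ) (iht _ hσ)
  | t_app hs hS ih => exact .t_app hσ hs hS (ih _ hσ)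
  | q_app hs hR ih => exact .q_app hσ hs hR (ih _ hσ)
  | typ_assert hs hQP ih => exact .typ_assert hσ hs hQP (ih _ hσ)
  | typ_upqual hs hQP ih => exact .typ_upqual hσ hs hQP (ih _ hσ)
  | ref_intro hs ih => exact .ref_intro hσ hs (ih _ hσ)
  | ref_elim hs ih => exact .ref_elim hσ hs (ih _ hσ)
  | ref_update hs ht ihs iht => exact .ref_update hσ hs ht (ihs _ hσ) (iht _ hσ)
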